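/- Let $f\in C([0,1])$ satisfy (H) $f(0)=f(1)=0$ and, for some $k>0$, $|f(s)|\le ks$ and $|f(s)|\le k(1-s)$ for all $s\in[0,1]$. Let $f$ be of type B (combustion type): for some $\alpha\in(0,1)$, $f=0$ on $[0,\alpha]$ and $f>0$ on $(\alpha,1)$. Assume that $f|_{[\alpha,1]}$ satisfies (F) $f|_{[\alpha,1]}$ is locally Lipschitz continuous and has a unique local maximum point, which lies in $(\alpha,1)$. For $\varepsilon>0$ call $c\in\mathbb R$ an admissible speed if the problem $$y'=c\,\frac{\sqrt{y(2\varepsilon+y)}}{\varepsilon+y}-f(v)\ \text{ on } [0,1],\qquad y(0)=y(1)=0,\quad y>0\text{ on }(0,1),$$ has a solution $y=y(v)$. Then for every $\varepsilon>0$ there is exactly one admissible speed $c^*_\varepsilon$ (the critical speed), and there is exactly one monotone solution $v_\varepsilon:\mathbb R\to\mathbb R$, with $|v_\varepsilon'|<1$, of $$\varepsilon\left(\frac{v_\varepsilon'}{\sqrt{1-(v_\varepsilon')^2}}\right)'-c^*_\varepsilon v_\varepsilon'+f(v_\varepsilon)=0,\qquad v_\varepsilon(-\infty)=0,\quad v_\varepsilon(+\infty)=1,\quad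 v_\varepsilon(0)=\alpha$$ (the critical front). Set $F(v)=\int_0^v f(s)\,ds$. The equation $F(v)=vf(v)$ has a largest solution $v_+$ in $[0,1]$, it satisfies $\alpha<v_+<1$, and, as $\varepsilon\to0^+$, $c^*_\varepsilon\to f(v_+)$ and $v_\varepsilon\to\bar v$ uniformly in $\mathbb R$, where $$\bar v(z)=\begin{cases}\mathcal V_L(z;0,\alpha), & z\le v_+-\alpha,\\ \mathcal V_I(z;v_+-\alpha,v_+), & z>v_+-\alpha.\end{cases}$$ Here $\mathcal V_L(z;z_0,v_0)$ equals $0$ for $z<z_0-v_0$, equals $z-z_0+v_0$ for $z_0-v_0\le z\le 1+z_0-v_0$, and equals $1$ for $z>1+z_0-v_0$; and $\mathcal V_I(\cdot;z_0,v_0)$ is the unique solution $v:\mathbb R\to[0,1]$ of the inviscid problem $f(v_+)\,v'=f(v)$ on $\mathbb R$, $v(z_0)=v_0$. -/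

import Mathlib

open Set Filter Topology

noncomputable section

/-- Assumption (H): `f` is continuous on `[0, 1]`, vanishes at `0` and `1`, and is linearly
controlled at both ends. Only the values of `f` on `[0, 1]` matter. -/
structure HypH (f : ℝ → ℝ) : Prop where
  continuousOn : ContinuousOn f (Icc 0 1)
  map_zero : f 0 = 0
  map_one : f 1 = 0
  linear_control : ∃ k : ℝ, 0 < k ∧ ∀ s ∈ Icc (0 : ℝ) 1, |f s| ≤ k * s ∧ |f s| ≤ k * (1 - s)

/-- `f` is of type B (combustion type) with ignition threshold `α`. -/
structure IsTypeB (f : ℝ → ℝ) (α : ℝ) : Prop where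
  threshold_mem : α ∈ Ioo (0 : ℝ) 1
  eq_zero : ∀ u ∈ Icc 0 α, f u = 0
  pos : ∀ u ∈ Ioo α 1, 0 < f u

/-- Assumption (F) for the restriction of `f` to `[p, q]`: this restriction is locally Lipschitz
and has a unique local maximum point, which is interior. -/
structure HypFOn (f : ℝ → ℝ) (p q : ℝ) : Prop where
  locallyLipschitz : LocallyLipschitzOn (Icc p q) f
  unique_localMax : ∃ vmax ∈ Ioo p q,
    ∀ x ∈ Icc p q, IsLocalMaxOn f (Icc p q) x ↔ x = vmax

/-- The primitive `F(v) = ∫₀ᵛ f(s) ds`. -/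
def reactionPrimitive (f : ℝ → ℝ) (v : ℝ) : ℝ := ∫ s in (0 : ℝ)..v, f s

/-- `y` solves the first-order reduction
`y' = c √(y (2ε + y)) / (ε + y) - f(v)`, `y(0) = y(1) = 0`, `y > 0` on `(0, 1)`. -/
structure IsFirstOrderSolution (f : ℝ → ℝ) (ε c : ℝ) (y : ℝ → ℝ) : Prop where
  ode : ∀ v ∈ Icc (0 : ℝ) 1,
    HasDerivWithinAt y (c * (√(y v * (2 * ε + y v)) / (ε + y v)) - f v) (Icc 0 1) v
  map_zero : y 0 = 0
  map_one : y 1 = 0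
  pos : ∀ v ∈ Ioo (0 : ℝ) 1, 0 < y v

/-- `c` is an admissible speed: the first-order two-point problem is solvable. -/
def IsAdmissibleSpeed (f : ℝ → ℝ) (ε c : ℝ) : Prop :=
  ∃ y : ℝ → ℝ, IsFirstOrderSolution f ε c y

/-- The critical speed `c*_ε`, i.e. the least admissible speed. -/
def criticalSpeed (f : ℝ → ℝ) (ε : ℝ) : ℝ := sInf {c : ℝ | IsAdmissibleSpeed f ε c}

/-- `v` is a monotone heteroclinic solution, joining `0` and `1`, of
`ε (v' / √(1 - (v')²))' - c v' + f(v) = 0` on the whole real line. -/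
structure IsFront (f : ℝ → ℝ) (ε c : ℝ) (v : ℝ → ℝ) : Prop where
  monotone : Monotone v
  differentiable : Differentiable ℝ v
  slope_lt_one : ∀ z, |deriv v z| < 1
  ode : ∀ z, HasDerivAt (fun s => ε * (deriv v s / √(1 - deriv v s ^ 2)))
    (c * deriv v z - f (v z)) z
  tendsto_atBot : Tendsto v atBot (𝓝 0)
  tendsto_atTop : Tendsto v atTop (𝓝 1)

/-- `v` is the critical front `v_ε`, normalized by `v(0) = V₀`. -/
def IsCriticalFront (f : ℝ → ℝ) (V₀ ε : ℝ) (v : ℝ → ℝ) : Prop :=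
  IsFront f ε (criticalSpeed f ε) v ∧ v 0 = V₀

/-- The piecewise linear profile `𝒱_L(z; z₀, v₀)`. -/
def piecewiseLinearProfile (z₀ v₀ z : ℝ) : ℝ :=
  if z < z₀ - v₀ then 0 else if z ≤ 1 + z₀ - v₀ then z - z₀ + v₀ else 1

/-- `V` is the inviscid profile `𝒱_I(·; z₀, v₀)`: it is `[0, 1]`-valued and solves
`c V' = f(V)` on the real line, `V(z₀) = v₀`. -/
structure IsInviscidProfile (f : ℝ → ℝ) (c z₀ v₀ : ℝ) (V : ℝ → ℝ) : Prop where
  mem_Icc : ∀ z, V z ∈ Icc (0 : ℝ) 1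
  differentiable : Differentiable ℝ V
  ode : ∀ z, c * deriv V z = f (V z)
  initial : V z₀ = v₀

/-- The profile equal to `L` on `(-∞, p]` and to `R` on `(p, +∞)`. -/
def gluedProfile (p : ℝ) (L R : ℝ → ℝ) (z : ℝ) : ℝ := if z ≤ p then L z else R z

end

/-!
Along a front the quantity `y = ε (1 / √(1 - v'²) - 1)` is a function of the state `v`; it solves
`y' = c φ(y) - f(v)` with `y(0) = y(1) = 0`, and `v' = φ(y)` recovers the front as the inverse of
its travel time. The solution starting backwards from `y(1) = 0` exists for every `c` and, at fixed
`v < 1`, decreases in `c`. On `[0, α]`, where `f = 0`, the problem is solved explicitly: the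
momentum `ε v' / √(1 - v'²)` equals `c v`. Matching the two pieces at `α` therefore determines `c`.

As `ε → 0⁺` the slope `φ(y)` tends to `1` wherever `y` stays away from `0`, so that
`y ≈ c v - F(v)`. This is only compatible with `y ≥ 0` and `y(1) = 0` if the line `c v` is the
tangent to the graph of `F` from the origin, i.e. `c = f(vp)` with `F(vp) = vp f(vp)`. Before `vp`
the front then has slope close to `1`; beyond it `y → 0`, which forces `c φ(y) ≈ f(v)`, the
inviscid equation. Grönwall's inequality turns the convergence of slopes into convergence of fronts
on bounded intervals, and monotonicity controls the tails.
-/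

/-! ### Calculus on intervals -/

section Calculus

variable {a b : ℝ}

theorem sub_le_sub_of_hasDerivWithinAt_le {s : Set ℝ} {g g' h h' : ℝ → ℝ} (hab : a ≤ b)
    (hs : Icc a b ⊆ s) (hg : ∀ x ∈ Icc a b, HasDerivWithinAt g (g' x) s x)
    (hh : ∀ x ∈ Icc a b, HasDerivWithinAt h (h' x) s x) (hle : ∀ x ∈ Ioo a b, g' x ≤ h' x) :
    g b - g a ≤ h b - h a := by
  have hd : ∀ x ∈ Icc a b, HasDerivWithinAt (fun x => h x - g x) (h' x - g' x) (Icc a b) x :=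
    fun x hx => ((hh x hx).sub (hg x hx)).mono hs
  have hmono : MonotoneOn (fun x => h x - g x) (Icc a b) := by
    refine monotoneOn_of_hasDerivWithinAt_nonneg (f' := fun x => h' x - g' x) (convex_Icc a b)
      (fun x hx => (hd x hx).continuousWithinAt)
      (fun x hx => (hd x (interior_subset hx)).mono interior_subset) fun x hx => ?_
    rw [interior_Icc] at hx
    exact sub_nonneg.2 (hle x hx)
  have := hmono (left_mem_Icc.2 hab) (right_mem_Icc.2 hab) hab
  linarith

theorem pos_of_hasDerivWithinAt_nonneg_of_nonneg {d d' : ℝ → ℝ} (hab : a ≤ b)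
    (hd : ∀ t ∈ Icc a b, HasDerivWithinAt d (d' t) (Icc a b) t) (ha : 0 < d a)
    (h : ∀ t ∈ Icc a b, 0 ≤ d t → 0 ≤ d' t) : 0 < d b := by
  -- The line through `(a, d a)` of slope `-η` is a barrier that is still positive at `b`.
  have hlen : 0 < b - a + 1 := by linarith
  set η := d a / (b - a + 1)
  have hη : 0 < η := div_pos ha hlen
  have hηab : ∀ t ≤ b, η * (t - a) < d a := fun t ht => by
    have hmul : η * (b - a + 1) = d a := div_mul_cancel₀ _ hlen.ne'
    nlinarith
  have hbarrier : -d b ≤ η * (b - a) - d a := by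
    refine image_le_of_deriv_right_lt_deriv_boundary' (f := fun t => -d t) (f' := fun t => -d' t)
      (B := fun t => η * (t - a) - d a) (B' := fun _ => η)
      (fun t ht => (hd t ht).continuousWithinAt.neg)
      (fun t ht => ((hd t ⟨ht.1, ht.2.le⟩).mono_of_mem_nhdsWithin
        (Icc_mem_nhdsGE_of_mem ht)).neg)
      (by simp) (by fun_prop)
      (fun t _ => ?_) (fun t ht heq => ?_) (right_mem_Icc.2 hab)
    · simpa using (((hasDerivWithinAt_id t (Ici t)).sub_const a).const_mul η).sub_const (d a)
    · have hdt : 0 ≤ d t := by linarith [hηab t ht.2.le]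
      linarith [h t ⟨ht.1, ht.2.le⟩ hdt]
  linarith [hηab b le_rfl]

theorem le_add_mul_of_right_le {η : ℝ} {y₁ y₁' y₂ y₂' : ℝ → ℝ} (hη : 0 ≤ η)
    (h₁ : ∀ t ∈ Icc a b, HasDerivWithinAt y₁ (y₁' t) (Icc a b) t)
    (h₂ : ∀ t ∈ Icc a b, HasDerivWithinAt y₂ (y₂' t) (Icc a b) t)
    (h : ∀ t ∈ Icc a b, y₁ t ≤ y₂ t → y₁' t ≤ y₂' t + η) (hb : y₂ b ≤ y₁ b) :
    ∀ t ∈ Icc a b, y₂ t ≤ y₁ t + η * (b - t) := by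
  intro t ht
  by_contra! hlt
  have hsub : Icc t b ⊆ Icc a b := Icc_subset_Icc_left ht.1
  have hpos := pos_of_hasDerivWithinAt_nonneg_of_nonneg (d := fun s => y₂ s - y₁ s - η * (b - s))
    (d' := fun s => y₂' s - y₁' s - η * (0 - 1)) ht.2
    (fun s hs => (((h₂ s (hsub hs)).sub (h₁ s (hsub hs))).mono hsub).sub
      (((hasDerivWithinAt_const s _ b).sub (hasDerivWithinAt_id s _)).const_mul η))
    (by linarith) (fun s hs hds => ?_)
  · simp only [sub_self, mul_zero] at hpos
    linarith
  · have := mul_nonneg hη (sub_nonneg.2 hs.2)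
    linarith [h s (hsub hs) (by linarith)]

theorem hasDerivWithinAt_integral_of_continuousOn {g : ℝ → ℝ} {c t : ℝ}
    (hg : ContinuousOn g (Icc a b)) (hc : c ∈ Icc a b) (ht : t ∈ Icc a b) :
    HasDerivWithinAt (fun t => ∫ s in c..t, g s) (g t) (Icc a b) t := by
  have : Fact (t ∈ Icc a b) := ⟨ht⟩
  exact intervalIntegral.integral_hasDerivWithinAt_right
    (hg.mono (ordConnected_Icc.uIcc_subset hc ht)).intervalIntegrable
    (hg.stronglyMeasurableAtFilter_nhdsWithin measurableSet_Icc t) (hg t ht)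

theorem integral_eq_sub_of_hasDerivWithinAt {y y' : ℝ → ℝ} {c t : ℝ}
    (hy' : ContinuousOn y' (Icc a b))
    (hy : ∀ t ∈ Icc a b, HasDerivWithinAt y (y' t) (Icc a b) t)
    (hc : c ∈ Icc a b) (ht : t ∈ Icc a b) : ∫ s in c..t, y' s = y t - y c := by
  have hsub : uIcc c t ⊆ Icc a b := ordConnected_Icc.uIcc_subset hc ht
  refine intervalIntegral.integral_eq_sub_of_hasDeriv_right
    (fun s hs => ((hy s (hsub hs)).mono hsub).continuousWithinAt) (fun s hs => ?_)
    (hy'.mono hsub).intervalIntegrable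
  exact ((hy s (hsub (Ioo_subset_Icc_self hs))).mono hsub).hasDerivAt
    (Icc_mem_nhds hs.1 hs.2) |>.hasDerivWithinAt

theorem hasDerivWithinAt_of_tendstoUniformlyOn {Y Y' : ℕ → ℝ → ℝ} {y y' : ℝ → ℝ}
    (hY : ∀ n, ∀ t ∈ Icc a b, HasDerivWithinAt (Y n) (Y' n t) (Icc a b) t)
    (hY' : ∀ n, ContinuousOn (Y' n) (Icc a b)) (hlim' : TendstoUniformlyOn Y' y' atTop (Icc a b))
    (hlim : ∀ t ∈ Icc a b, Tendsto (fun n => Y n t) atTop (𝓝 (y t))) :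
    ∀ t ∈ Icc a b, HasDerivWithinAt y (y' t) (Icc a b) t := by
  intro t ht
  have hy' : ContinuousOn y' (Icc a b) := hlim'.continuousOn (Frequently.of_forall hY')
  have hint : ∀ s ∈ Icc a b, y s = y t + ∫ r in t..s, y' r := by
    intro s hs
    have hsub : uIcc t s ⊆ Icc a b := ordConnected_Icc.uIcc_subset ht hs
    have hlimint : Tendsto (fun n => ∫ r in t..s, Y' n r) atTop (𝓝 (∫ r in t..s, y' r)) :=
      TendstoUniformlyOn.tendsto_intervalIntegral_of_continuousOn
        (Eventually.of_forall fun n => (hY' n).mono hsub) (hlim'.mono hsub)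
    refine tendsto_nhds_unique (hlim s hs) (((hlim t ht).add hlimint).congr fun n => ?_)
    rw [integral_eq_sub_of_hasDerivWithinAt (hY' n) (hY n) ht hs]
    ring
  exact ((hasDerivWithinAt_integral_of_continuousOn hy' ht ht).const_add (y t)).congr hint
    (hint t ht)

theorem eq_zero_of_tendsto_atBot_of_tendsto_deriv {v v' : ℝ → ℝ} {c l : ℝ}
    (hv : ∀ z, HasDerivAt v (v' z) z) (hlim : Tendsto v atBot (𝓝 c))
    (hlim' : Tendsto v' atBot (𝓝 l)) : l = 0 := by
  have hmvt : ∀ z, ∃ x ∈ Ioo (z - 1) z, v' x = v z - v (z - 1) := fun z => by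
    obtain ⟨x, hx, heq⟩ := exists_hasDerivAt_eq_slope v v' (sub_one_lt z)
      (fun x _ => (hv x).continuousAt.continuousWithinAt) fun x _ => hv x
    exact ⟨x, hx, by rw [heq, sub_sub_cancel, div_one]⟩
  choose x hx hxv using hmvt
  have hxlim : Tendsto x atBot atBot := tendsto_atBot_mono (fun z => (hx z).2.le) tendsto_id
  have hincr : Tendsto (fun z => v z - v (z - 1)) atBot (𝓝 (c - c)) :=
    hlim.sub (hlim.comp (tendsto_atBot_add_const_right _ (-1) tendsto_id))
  rw [sub_self] at hincr
  exact tendsto_nhds_unique (hlim'.comp hxlim) (hincr.congr fun z => (hxv z).symm)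

end Calculus

/-! ### The slope of a front -/

/-- The slope `v' = √(y (2ε + y)) / (ε + y)` of a front as a function of the first-order variable
`y = ε (1 / √(1 - v'²) - 1)`. -/
noncomputable def frontSlope (ε y : ℝ) : ℝ := √(y * (2 * ε + y)) / (ε + y)

section FrontSlope

variable {ε y z δ : ℝ}

theorem frontSlope_zero (ε : ℝ) : frontSlope ε 0 = 0 := by simp [frontSlope]

theorem frontSlope_nonneg (hε : 0 < ε) (hy : 0 ≤ y) : 0 ≤ frontSlope ε y := by
  unfold frontSlope; positivity

theorem frontSlope_pos (hε : 0 < ε) (hy : 0 < y) : 0 < frontSlope ε y := by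
  unfold frontSlope; positivity

theorem frontSlope_sq (hε : 0 < ε) (hy : 0 ≤ y) :
    frontSlope ε y ^ 2 = 1 - (ε / (ε + y)) ^ 2 := by
  rw [frontSlope, div_pow, Real.sq_sqrt (by positivity)]
  field_simp
  ring

theorem frontSlope_lt_one (hε : 0 < ε) (hy : 0 ≤ y) : frontSlope ε y < 1 := by
  have hpos : 0 < (ε / (ε + y)) ^ 2 := by positivity
  nlinarith [frontSlope_sq hε hy, frontSlope_nonneg hε hy]

theorem monotoneOn_frontSlope (hε : 0 < ε) : MonotoneOn (frontSlope ε) (Ici 0) := by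
  intro y (hy : 0 ≤ y) z (hz : 0 ≤ z) hyz
  refine le_of_sq_le_sq ?_ (frontSlope_nonneg hε hz)
  rw [frontSlope_sq hε hy, frontSlope_sq hε hz]
  gcongr

theorem continuousOn_frontSlope (hε : 0 < ε) : ContinuousOn (frontSlope ε) (Ici 0) := by
  refine ContinuousOn.div (by fun_prop) (by fun_prop) fun y (hy : 0 ≤ y) => ?_
  positivity

theorem frontSlope_sq_sub_le (hε : 0 < ε) (hy : 0 ≤ y) (hyz : y ≤ z) :
    frontSlope ε z ^ 2 - frontSlope ε y ^ 2 ≤ 2 * ((z - y) / ε) := by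
  have hεy : 0 < ε + y := by linarith
  have hεz : 0 < ε + z := by linarith
  have hy1 : ε / (ε + y) ≤ 1 := (div_le_one hεy).2 (by linarith)
  have hz1 : ε / (ε + z) ≤ 1 := (div_le_one hεz).2 (by linarith)
  have hz0 : 0 < ε / (ε + z) := by positivity
  have hy0 : 0 < ε / (ε + y) := by positivity
  have hdiv : 0 ≤ (z - y) / ε := div_nonneg (by linarith) hε.le
  have hdiff : ε / (ε + y) - ε / (ε + z) ≤ (z - y) / ε := by
    calc ε / (ε + y) - ε / (ε + z) = (z - y) / ε * (ε / (ε + y) * (ε / (ε + z))) := by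
          field_simp; ring
      _ ≤ (z - y) / ε * 1 := by gcongr; nlinarith
      _ = (z - y) / ε := mul_one _
  rw [frontSlope_sq hε hy, frontSlope_sq hε (hy.trans hyz)]
  nlinarith

theorem exists_lipschitzOnWith_frontSlope (hε : 0 < ε) (hδ : 0 < δ) :
    ∃ K, LipschitzOnWith K (frontSlope ε) (Ici δ) := by
  have hslope : 0 < frontSlope ε δ := frontSlope_pos hε hδ
  have hK : 0 ≤ 1 / (ε * frontSlope ε δ) := by positivity
  refine ⟨⟨_, hK⟩, LipschitzOnWith.of_le_add_mul _ fun z hz y hy => ?_⟩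
  change frontSlope ε z ≤ frontSlope ε y + 1 / (ε * frontSlope ε δ) * dist z y
  have hy0 : 0 ≤ y := hδ.le.trans hy
  have hz0 : 0 ≤ z := hδ.le.trans hz
  rcases le_total z y with hzy | hyz
  · have := monotoneOn_frontSlope hε hz0 hy0 hzy
    have : 0 ≤ 1 / (ε * frontSlope ε δ) * dist z y := by positivity
    linarith
  · -- `φ z - φ y = (φ z ^ 2 - φ y ^ 2) / (φ z + φ y)`, where `φ z + φ y ≥ 2 φ δ`
    rw [Real.dist_eq, abs_of_nonneg (sub_nonneg.2 hyz), ← sub_le_iff_le_add',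
      show 1 / (ε * frontSlope ε δ) * (z - y) = (z - y) / ε / frontSlope ε δ by field_simp,
      le_div_iff₀ hslope]
    have hsq := frontSlope_sq_sub_le hε hy0 hyz
    have hδy := monotoneOn_frontSlope hε hδ.le hy0 hy
    have hδz := monotoneOn_frontSlope hε hδ.le hz0 hz
    have := monotoneOn_frontSlope hε hy0 hz0 hyz
    nlinarith

theorem monotone_frontSlope_max (hε : 0 < ε) (hδ : 0 ≤ δ) :
    Monotone fun y => frontSlope ε (max y δ) := fun _ _ h =>
  monotoneOn_frontSlope hε (hδ.trans (le_max_right _ _)) (hδ.trans (le_max_right _ _))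
    (max_le_max_right _ h)

theorem exists_lipschitzWith_frontSlope_max (hε : 0 < ε) (hδ : 0 < δ) :
    ∃ K, LipschitzWith K fun y => frontSlope ε (max y δ) := by
  obtain ⟨K, hK⟩ := exists_lipschitzOnWith_frontSlope hε hδ
  exact ⟨_, lipschitzOnWith_univ.1 (hK.comp (LipschitzWith.id.max_const δ).lipschitzOnWith
    fun y _ => le_max_right y δ)⟩

theorem abs_frontSlope_max_sub_le (hε : 0 < ε) (hδ : 0 ≤ δ) (y : ℝ) :
    |frontSlope ε (max y 0) - frontSlope ε (max y δ)| ≤ frontSlope ε δ := by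
  have hmono : frontSlope ε (max y 0) ≤ frontSlope ε (max y δ) :=
    monotoneOn_frontSlope hε (mem_Ici.2 (le_max_right y 0)) (hδ.trans (le_max_right y δ))
      (max_le_max_left y hδ)
  have hδ0 := frontSlope_nonneg hε hδ
  have hy0 := frontSlope_nonneg hε (le_max_right y 0)
  rw [abs_sub_comm, abs_of_nonneg (sub_nonneg.2 hmono)]
  rcases le_total y δ with h | h
  · rw [max_eq_right h]; linarith
  · rw [max_eq_left h, max_eq_left (hδ.trans h)]; linarith

theorem tendstoUniformly_frontSlope_max (hε : 0 < ε) :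
    TendstoUniformly (fun (n : ℕ) y => frontSlope ε (max y (1 / (n + 1))))
      (fun y => frontSlope ε (max y 0)) atTop := by
  have hzero : Tendsto (fun n : ℕ => frontSlope ε (1 / (n + 1))) atTop (𝓝 0) := by
    have h := (continuousOn_frontSlope hε 0 self_mem_Ici).tendsto.comp
      (tendsto_nhdsWithin_iff.2 ⟨tendsto_one_div_add_atTop_nhds_zero_nat (𝕜 := ℝ),
        Eventually.of_forall fun n => mem_Ici.2 Nat.one_div_pos_of_nat.le⟩)
    rwa [frontSlope_zero] at h
  rw [Metric.tendstoUniformly_iff]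
  intro η hη
  filter_upwards [hzero.eventually (gt_mem_nhds hη)] with n hn y
  exact (abs_frontSlope_max_sub_le hε Nat.one_div_pos_of_nat.le y).trans_lt hn

theorem tendsto_frontSlope (hy : 0 < y) : Tendsto (fun ε => frontSlope ε y) (𝓝[>] 0) (𝓝 1) := by
  have hcont : ContinuousAt (fun ε => frontSlope ε y) 0 := by
    unfold frontSlope
    exact ContinuousAt.div (by fun_prop) (by fun_prop) (by simp [hy.ne'])
  have hzero : frontSlope 0 y = 1 := by
    rw [frontSlope, mul_zero, zero_add, Real.sqrt_mul_self hy.le, div_self hy.ne']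
  exact hzero ▸ hcont.tendsto.mono_left nhdsWithin_le_nhds

theorem momentum_frontSlope (hε : 0 < ε) (hy : 0 ≤ y) :
    ε * (frontSlope ε y / √(1 - frontSlope ε y ^ 2)) = √(y * (2 * ε + y)) := by
  rw [frontSlope_sq hε hy, sub_sub_cancel, Real.sqrt_sq (by positivity), frontSlope]
  field_simp

end FrontSlope

/-- The slope of a front as a function of its momentum `r = ε v' / √(1 - v'²)`. -/
noncomputable def slopeOfMomentum (ε r : ℝ) : ℝ := r / √(ε ^ 2 + r ^ 2)

/-- The first-order variable `y` as a function of the momentum `r = ε v' / √(1 - v'²)`: the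
kinetic energy of a relativistic particle of mass `ε`. -/
noncomputable def energyOfMomentum (ε r : ℝ) : ℝ := √(ε ^ 2 + r ^ 2) - ε

section Momentum

variable {ε r : ℝ}

theorem energyOfMomentum_zero (hε : 0 < ε) : energyOfMomentum ε 0 = 0 := by
  simp [energyOfMomentum, Real.sqrt_sq hε.le]

theorem sub_le_energyOfMomentum (ε r : ℝ) : r - ε ≤ energyOfMomentum ε r :=
  sub_le_sub_right (Real.le_sqrt_of_sq_le (by nlinarith [sq_nonneg ε])) ε

theorem strictMonoOn_energyOfMomentum (hε : 0 < ε) :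
    StrictMonoOn (energyOfMomentum ε) (Ici 0) := by
  intro r (hr : 0 ≤ r) s _ hrs
  unfold energyOfMomentum
  gcongr

theorem energyOfMomentum_pos (hε : 0 < ε) (hr : 0 < r) : 0 < energyOfMomentum ε r :=
  energyOfMomentum_zero hε ▸ strictMonoOn_energyOfMomentum hε self_mem_Ici hr.le hr

theorem energyOfMomentum_nonneg (hε : 0 < ε) (hr : 0 ≤ r) : 0 ≤ energyOfMomentum ε r :=
  energyOfMomentum_zero hε ▸ (strictMonoOn_energyOfMomentum hε).monotoneOn self_mem_Ici hr hr

theorem energyOfMomentum_sqrt (hε : 0 < ε) {y : ℝ} (hy : 0 ≤ y) :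
    energyOfMomentum ε √(y * (2 * ε + y)) = y := by
  rw [energyOfMomentum, Real.sq_sqrt (by positivity),
    show ε ^ 2 + y * (2 * ε + y) = (ε + y) ^ 2 by ring, Real.sqrt_sq (by positivity),
    add_sub_cancel_left]

theorem hasDerivAt_energyOfMomentum (hε : 0 < ε) (r : ℝ) :
    HasDerivAt (energyOfMomentum ε) (slopeOfMomentum ε r) r := by
  have hd := ((((hasDerivAt_id r).fun_pow 2).const_add (ε ^ 2)).sqrt
    (by simp only [id]; positivity)).sub_const ε
  refine hd.congr_deriv ?_
  simp only [id, Nat.cast_ofNat, Nat.reduceSub, pow_one, mul_one, slopeOfMomentum]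
  exact mul_div_mul_left _ _ two_ne_zero

theorem frontSlope_energyOfMomentum (hε : 0 < ε) (hr : 0 ≤ r) :
    frontSlope ε (energyOfMomentum ε r) = slopeOfMomentum ε r := by
  have hsq : √(ε ^ 2 + r ^ 2) ^ 2 = ε ^ 2 + r ^ 2 := Real.sq_sqrt (by positivity)
  have hprod : energyOfMomentum ε r * (2 * ε + energyOfMomentum ε r) = r ^ 2 := by
    unfold energyOfMomentum
    nlinarith
  rw [frontSlope, hprod, Real.sqrt_sq hr, energyOfMomentum, add_sub_cancel, slopeOfMomentum]

theorem lipschitzWith_slopeOfMomentum (hε : 0 < ε) :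
    LipschitzWith (1 / ε).toNNReal (slopeOfMomentum ε) := by
  have hd : ∀ r : ℝ, HasDerivAt (slopeOfMomentum ε) (ε ^ 2 / √(ε ^ 2 + r ^ 2) ^ 3) r := by
    intro r
    have hsq : √(ε ^ 2 + r ^ 2) ^ 2 = ε ^ 2 + r ^ 2 := Real.sq_sqrt (by positivity)
    have hsqrt := (((hasDerivAt_id r).fun_pow 2).const_add (ε ^ 2)).sqrt
      (by simp only [id]; positivity)
    refine ((hasDerivAt_id r).fun_div hsqrt (by simp only [id]; positivity)).congr_deriv ?_
    simp only [id, Nat.cast_ofNat, Nat.reduceSub, pow_one]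
    field_simp
    rw [hsq]
    ring
  refine lipschitzWith_of_nnnorm_deriv_le (fun r => (hd r).differentiableAt) fun r => ?_
  rw [← NNReal.coe_le_coe, coe_nnnorm, Real.coe_toNNReal _ (by positivity), (hd r).deriv,
    Real.norm_of_nonneg (by positivity), div_le_div_iff₀ (by positivity) hε, one_mul, ← pow_succ]
  gcongr
  exact Real.le_sqrt_of_sq_le (by nlinarith [sq_nonneg r])

theorem slopeOfMomentum_eq_zero_iff (hε : 0 < ε) : slopeOfMomentum ε r = 0 ↔ r = 0 := by
  have : √(ε ^ 2 + r ^ 2) ≠ 0 := by positivity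
  simp only [slopeOfMomentum, div_eq_zero_iff, this, or_false]

end Momentum

/-! ### Backward solvability of `y' = Φ(y) - f(t)` -/

section BackwardSolvability

variable {a b yb : ℝ} {f Φ : ℝ → ℝ}

theorem exists_backward_solution_of_lipschitz {K : NNReal} {M : ℝ} (hab : a ≤ b)
    (hΦ : LipschitzWith K Φ) (hM : ∀ y, |Φ y| ≤ M) (hf : ContinuousOn f (Icc a b)) :
    ∃ y : ℝ → ℝ, y b = yb ∧
      ∀ t ∈ Icc a b, HasDerivWithinAt y (Φ (y t) - f t) (Icc a b) t := by
  obtain ⟨B, hB⟩ := isCompact_Icc.exists_bound_of_continuousOn hf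
  have hL : 0 ≤ M + B :=
    add_nonneg ((abs_nonneg _).trans (hM 0)) ((norm_nonneg _).trans (hB b (right_mem_Icc.2 hab)))
  obtain ⟨L, hL⟩ : ∃ L : NNReal, (L : ℝ) = M + B := ⟨⟨M + B, hL⟩, rfl⟩
  have hPL : IsPicardLindelof (fun t x => Φ x - f t) (⟨b, right_mem_Icc.2 hab⟩ : Icc a b) yb
      (L * (b - a).toNNReal) 0 L K :=
    { lipschitzOnWith := fun t _ => (LipschitzWith.of_dist_le_mul fun x y => by
        rw [dist_sub_right]
        exact hΦ.dist_le_mul x y).lipschitzOnWith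
      continuousOn := fun x _ => continuousOn_const.sub hf
      norm_le := fun t ht x _ => by
        rw [hL]
        exact (norm_sub_le _ _).trans (add_le_add (hM x) (hB t ht))
      mul_max_le := by simp [hab] }
  exact hPL.exists_eq_forall_mem_Icc_hasDerivWithinAt₀

theorem abs_sub_le_of_backward_solution {Ψ₁ Ψ₂ y₁ y₂ : ℝ → ℝ} {η₁ η₂ : ℝ}
    (hmono₁ : Monotone Ψ₁) (hmono₂ : Monotone Ψ₂) (hη₁ : ∀ y, |Φ y - Ψ₁ y| ≤ η₁)
    (hη₂ : ∀ y, |Φ y - Ψ₂ y| ≤ η₂)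
    (h₁ : ∀ t ∈ Icc a b, HasDerivWithinAt y₁ (Ψ₁ (y₁ t) - f t) (Icc a b) t)
    (h₂ : ∀ t ∈ Icc a b, HasDerivWithinAt y₂ (Ψ₂ (y₂ t) - f t) (Icc a b) t) (hb : y₁ b = y₂ b) :
    ∀ t ∈ Icc a b, |y₁ t - y₂ t| ≤ (η₁ + η₂) * (b - t) := by
  have hη : 0 ≤ η₁ + η₂ :=
    add_nonneg ((abs_nonneg _).trans (hη₁ 0)) ((abs_nonneg _).trans (hη₂ 0))
  have hΨ : ∀ y, |Ψ₁ y - Ψ₂ y| ≤ η₁ + η₂ := fun y =>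
    (abs_sub_le _ (Φ y) _).trans (add_le_add ((abs_sub_comm _ _).trans_le (hη₁ y)) (hη₂ y))
  intro t ht
  have h₂₁ := le_add_mul_of_right_le hη h₁ h₂ (fun s _ hs => by
    linarith [hmono₁ hs, (abs_le.1 (hΨ (y₂ s))).2]) hb.ge t ht
  have h₁₂ := le_add_mul_of_right_le hη h₂ h₁ (fun s _ hs => by
    linarith [hmono₂ hs, (abs_le.1 (hΨ (y₁ s))).1]) hb.le t ht
  rw [abs_le]
  constructor <;> linarith

theorem exists_backward_solution {Ψ : ℕ → ℝ → ℝ} (hab : a ≤ b) (hmono : ∀ n, Monotone (Ψ n))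
    (hlip : ∀ n, ∃ K, LipschitzWith K (Ψ n)) (hbdd : ∀ n, ∃ M, ∀ y, |Ψ n y| ≤ M)
    (hlim : TendstoUniformly Ψ Φ atTop) (hf : ContinuousOn f (Icc a b)) :
    ∃ y : ℝ → ℝ, y b = yb ∧
      ∀ t ∈ Icc a b, HasDerivWithinAt y (Φ (y t) - f t) (Icc a b) t := by
  choose K hK using hlip
  choose M hM using hbdd
  choose Y hYb hY using fun n =>
    exists_backward_solution_of_lipschitz (yb := yb) hab (hK n) (hM n) hf
  have hcauchy : UniformCauchySeqOn Y atTop (Icc a b) := by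
    rw [Metric.uniformCauchySeqOn_iff]
    intro η hη
    have hlen : 0 < 2 * (b - a + 1) := by linarith
    obtain ⟨N, hN⟩ := eventually_atTop.1 (Metric.tendstoUniformly_iff.1 hlim _ (div_pos hη hlen))
    refine ⟨N, fun m hm n hn t ht => ?_⟩
    have hdist := abs_sub_le_of_backward_solution (hmono m) (hmono n)
      (fun y => (hN m hm y).le) (fun y => (hN n hn y).le) (hY m) (hY n)
      ((hYb m).trans (hYb n).symm) t ht
    have hmul : η / (2 * (b - a + 1)) * (2 * (b - a + 1)) = η := div_mul_cancel₀ _ hlen.ne'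
    rw [Real.dist_eq]
    nlinarith [div_pos hη hlen, ht.1]
  choose! y hy using fun t ht => cauchySeq_tendsto_of_complete (hcauchy.cauchySeq (x := t) ht)
  have hunif : TendstoUniformlyOn Y y atTop (Icc a b) := hcauchy.tendstoUniformlyOn_of_tendsto hy
  have hΦ : UniformContinuous Φ :=
    hlim.uniformContinuous (Frequently.of_forall fun n => (hK n).uniformContinuous)
  have hunif' : TendstoUniformlyOn (fun n t => Ψ n (Y n t) - f t) (fun t => Φ (y t) - f t) atTop
      (Icc a b) := by
    rw [Metric.tendstoUniformlyOn_iff]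
    intro η hη
    filter_upwards [Metric.tendstoUniformly_iff.1 hlim _ (half_pos hη),
      Metric.tendstoUniformlyOn_iff.1 (hΦ.comp_tendstoUniformlyOn hunif) _ (half_pos hη)]
      with n hΨ hY t ht
    rw [dist_sub_right, ← add_halves η]
    exact (dist_triangle _ (Φ (Y n t)) _).trans_lt (add_lt_add (hY t ht) (hΨ _))
  have hb := right_mem_Icc.2 hab
  exact ⟨y, tendsto_nhds_unique (hy b hb) (by simp [hYb]),
    hasDerivWithinAt_of_tendstoUniformlyOn hY (fun n => ((hK n).continuous.comp_continuousOn
      fun t ht => (hY n t ht).continuousWithinAt).sub hf) hunif' hy⟩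

theorem exists_backward_frontSlope_solution {ε c : ℝ} (hε : 0 < ε) (hc : 0 ≤ c) (hab : a ≤ b)
    (hf : ContinuousOn f (Icc a b)) :
    ∃ y : ℝ → ℝ, y b = yb ∧ ∀ t ∈ Icc a b,
      HasDerivWithinAt y (c * frontSlope ε (max (y t) 0) - f t) (Icc a b) t := by
  have hδ : ∀ n : ℕ, (0 : ℝ) < 1 / (n + 1) := fun n => Nat.one_div_pos_of_nat
  refine exists_backward_solution (Φ := fun y => c * frontSlope ε (max y 0))
    (Ψ := fun n y => c * frontSlope ε (max y (1 / (n + 1)))) hab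
    (fun n => (monotone_frontSlope_max hε (hδ n).le).const_mul hc) (fun n => ?_)
    (fun n => ⟨c * 1, fun y => ?_⟩)
    ((uniformContinuous_const_smul c).comp_tendstoUniformly (tendstoUniformly_frontSlope_max hε))
    hf
  · obtain ⟨K, hK⟩ := exists_lipschitzWith_frontSlope_max hε (hδ n)
    exact ⟨_, (lipschitzWith_smul c).comp hK⟩
  · have hmax : (0 : ℝ) ≤ max y (1 / (n + 1)) := (hδ n).le.trans (le_max_right _ _)
    rw [abs_of_nonneg (mul_nonneg hc (frontSlope_nonneg hε hmax))]
    exact mul_le_mul_of_nonneg_left (frontSlope_lt_one hε hmax).le hc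

end BackwardSolvability

/-! ### The first-order problem -/

theorem IsTypeB.nonneg {f : ℝ → ℝ} {α : ℝ} (hB : IsTypeB f α) (hf1 : f 1 = 0) :
    ∀ t ∈ Icc (0 : ℝ) 1, 0 ≤ f t := by
  intro t ht
  rcases le_or_gt t α with htα | hαt
  · exact (hB.eq_zero t ⟨ht.1, htα⟩).ge
  · rcases ht.2.lt_or_eq with ht1 | rfl
    · exact (hB.pos t ⟨hαt, ht1⟩).le
    · exact hf1.ge

section ReactionPrimitive

variable {f : ℝ → ℝ} {u w p : ℝ}

theorem reactionPrimitive_zero (f : ℝ → ℝ) : reactionPrimitive f 0 = 0 :=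
  intervalIntegral.integral_same

theorem hasDerivWithinAt_reactionPrimitive (hf : ContinuousOn f (Icc 0 1)) :
    ∀ v ∈ Icc (0 : ℝ) 1, HasDerivWithinAt (reactionPrimitive f) (f v) (Icc 0 1) v :=
  fun _ hv => hasDerivWithinAt_integral_of_continuousOn hf (left_mem_Icc.2 zero_le_one) hv

theorem mul_sub_le_reactionPrimitive_sub (hf : ContinuousOn f (Icc 0 1)) (hu : 0 ≤ u)
    (huw : u ≤ w) (hw : w ≤ 1) (h : ∀ s ∈ Ioo u w, p ≤ f s) :
    p * (w - u) ≤ reactionPrimitive f w - reactionPrimitive f u := by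
  have hsub : Icc u w ⊆ Icc 0 1 := Icc_subset_Icc hu hw
  have := sub_le_sub_of_hasDerivWithinAt_le huw hsub
    (fun s _ => (hasDerivWithinAt_id s _).const_mul p)
    (fun s hs => hasDerivWithinAt_reactionPrimitive hf s (hsub hs))
    (fun s hs => (mul_one p).trans_le (h s hs))
  simpa only [id, mul_sub] using this

theorem reactionPrimitive_sub_le_mul_sub (hf : ContinuousOn f (Icc 0 1)) (hu : 0 ≤ u)
    (huw : u ≤ w) (hw : w ≤ 1) (h : ∀ s ∈ Ioo u w, f s ≤ p) :
    reactionPrimitive f w - reactionPrimitive f u ≤ p * (w - u) := by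
  have hsub : Icc u w ⊆ Icc 0 1 := Icc_subset_Icc hu hw
  have := sub_le_sub_of_hasDerivWithinAt_le huw hsub
    (fun s hs => hasDerivWithinAt_reactionPrimitive hf s (hsub hs))
    (fun s _ => (hasDerivWithinAt_id s _).const_mul p)
    (fun s hs => (h s hs).trans_eq (mul_one p).symm)
  simpa only [id, mul_sub] using this

end ReactionPrimitive

/-- The solution of the first-order equation with terminal value `y 1 = 0`; the truncation
`max (y t) 0` makes the equation meaningful before `y` is known to be nonnegative. -/
structure IsBackwardSolution (f : ℝ → ℝ) (ε c : ℝ) (y : ℝ → ℝ) : Prop where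
  ode : ∀ t ∈ Icc (0 : ℝ) 1,
    HasDerivWithinAt y (c * frontSlope ε (max (y t) 0) - f t) (Icc 0 1) t
  map_one : y 1 = 0

section BackwardSolution

variable {f y y' : ℝ → ℝ} {α ε c c' : ℝ}

theorem exists_isBackwardSolution (hε : 0 < ε) (hc : 0 ≤ c) (hf : ContinuousOn f (Icc 0 1)) :
    ∃ y, IsBackwardSolution f ε c y := by
  obtain ⟨y, hy1, hy⟩ := exists_backward_frontSlope_solution hε hc zero_le_one hf
  exact ⟨y, hy, hy1⟩

theorem IsBackwardSolution.nonneg (h : IsBackwardSolution f ε c y)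
    (hf : ∀ t ∈ Icc (0 : ℝ) 1, 0 ≤ f t) : ∀ t ∈ Icc (0 : ℝ) 1, 0 ≤ y t := by
  intro t ht
  have := le_add_mul_of_right_le (y₂ := fun _ => 0) le_rfl h.ode
    (fun t _ => hasDerivWithinAt_const t _ 0)
    (fun s hs hys => by simpa [max_eq_right hys, frontSlope_zero] using hf s hs) h.map_one.ge t ht
  simpa using this

theorem IsBackwardSolution.pos (h : IsBackwardSolution f ε c y)
    (hf : ∀ t ∈ Icc (0 : ℝ) 1, 0 ≤ f t) {t : ℝ} (ht : t ∈ Ioo (0 : ℝ) 1) (hft : 0 < f t) :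
    0 < y t := by
  refine (h.nonneg hf t (Ioo_subset_Icc_self ht)).lt_of_ne' fun hyt => ?_
  have hnhds := Icc_mem_nhds ht.1 ht.2
  have hmin : IsLocalMin y t := by
    filter_upwards [hnhds] with s hs
    exact hyt.trans_le (h.nonneg hf s hs)
  have hderiv := hmin.hasDerivAt_eq_zero
    ((h.ode t (Ioo_subset_Icc_self ht)).hasDerivAt hnhds)
  rw [hyt, max_self, frontSlope_zero] at hderiv
  linarith

theorem IsBackwardSolution.le_reactionPrimitive_sub (hε : 0 < ε) (hc : 0 ≤ c)
    (hf : ContinuousOn f (Icc 0 1)) (h : IsBackwardSolution f ε c y) :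
    ∀ t ∈ Icc (0 : ℝ) 1, y t ≤ reactionPrimitive f 1 - reactionPrimitive f t := by
  intro t ht
  have hsub : Icc t 1 ⊆ Icc 0 1 := Icc_subset_Icc_left ht.1
  have := sub_le_sub_of_hasDerivWithinAt_le ht.2 hsub
    (fun s hs => (hasDerivWithinAt_reactionPrimitive hf s (hsub hs)).neg)
    (fun s hs => h.ode s (hsub hs)) fun s _ => by
      linarith [mul_nonneg hc (frontSlope_nonneg hε (le_max_right (y s) 0))]
  simp only [Pi.neg_apply, h.map_one] at this
  linarith

theorem IsBackwardSolution.abs_sub_le (hε : 0 < ε) (hc : 0 ≤ c) (hc' : 0 ≤ c')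
    (h : IsBackwardSolution f ε c y) (h' : IsBackwardSolution f ε c' y') :
    ∀ t ∈ Icc (0 : ℝ) 1, |y t - y' t| ≤ |c - c'| := by
  have key : ∀ {c c' : ℝ} {y y' : ℝ → ℝ}, 0 ≤ c → IsBackwardSolution f ε c y →
      IsBackwardSolution f ε c' y' → ∀ t ∈ Icc (0 : ℝ) 1, y' t ≤ y t + |c - c'| := by
    intro c c' y y' hc h h' t ht
    refine (le_add_mul_of_right_le (abs_nonneg (c - c')) h.ode h'.ode (fun s _ hs => ?_)
      (h'.map_one.trans_le h.map_one.ge) t ht).trans ?_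
    · have hmono := mul_le_mul_of_nonneg_left (monotone_frontSlope_max hε le_rfl hs) hc
      have hslope0 := frontSlope_nonneg hε (le_max_right (y' s) 0)
      have hslope1 := frontSlope_lt_one hε (le_max_right (y' s) 0)
      nlinarith [le_abs_self (c - c'), abs_nonneg (c - c')]
    · nlinarith [abs_nonneg (c - c'), ht.1]
  intro t ht
  rw [abs_sub_le_iff]
  constructor
  · linarith [key hc' h' h t ht, abs_sub_comm c c']
  · linarith [key hc h h' t ht]

theorem exists_isBackwardSolution_eq_energyOfMomentum (hε : 0 < ε) (hH : HypH f)
    (hB : IsTypeB f α) :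
    ∃ c y, 0 < c ∧ IsBackwardSolution f ε c y ∧ y α = energyOfMomentum ε (c * α) := by
  have hα := hB.threshold_mem
  have hα01 : α ∈ Icc (0 : ℝ) 1 := Ioo_subset_Icc_self hα
  have hf0 := hB.nonneg hH.map_one
  choose! Y hY using fun c (hc : 0 ≤ c) => exists_isBackwardSolution hε hc hH.continuousOn
  have hcont : ContinuousOn (fun c => Y c α - energyOfMomentum ε (c * α)) (Ici 0) := by
    have hYcont : ContinuousOn (fun c => Y c α) (Ici 0) :=
      (LipschitzOnWith.of_dist_le_mul (K := 1) fun c hc c' hc' => by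
        simpa [Real.dist_eq] using
          (hY c hc).abs_sub_le hε hc hc' (hY c' hc') α hα01).continuousOn
    refine hYcont.sub ?_
    unfold energyOfMomentum
    fun_prop
  have hpos0 : 0 < Y 0 α := by
    have hmid : (α + 1) / 2 ∈ Ioo α 1 := ⟨by linarith [hα.2], by linarith [hα.2]⟩
    have hsub : Icc α ((α + 1) / 2) ⊆ Icc 0 1 := Icc_subset_Icc hα.1.le hmid.2.le
    have hdecr := sub_le_sub_of_hasDerivWithinAt_le hmid.1.le hsub
      (fun s hs => (hY 0 le_rfl).ode s (hsub hs)) (fun s _ => hasDerivWithinAt_const s _ 0)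
      fun s hs => by linarith [hf0 s (hsub (Ioo_subset_Icc_self hs))]
    linarith [(hY 0 le_rfl).pos hf0 ⟨hα.1.trans hmid.1, hmid.2⟩ (hB.pos _ hmid)]
  set M := reactionPrimitive f 1 - reactionPrimitive f α
  have hM : 0 ≤ M := hpos0.le.trans
    ((hY 0 le_rfl).le_reactionPrimitive_sub hε le_rfl hH.continuousOn α hα01)
  have hC : 0 ≤ (M + ε) / α := by have := hα.1; positivity
  obtain ⟨c, hc, hceq⟩ : ∃ c ∈ Icc 0 ((M + ε) / α), Y c α - energyOfMomentum ε (c * α) = 0 := by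
    refine intermediate_value_Icc' hC (hcont.mono Icc_subset_Ici_self) ⟨?_, ?_⟩
    · have := (hY _ hC).le_reactionPrimitive_sub hε hC hH.continuousOn α hα01
      have := sub_le_energyOfMomentum ε ((M + ε) / α * α)
      rw [div_mul_cancel₀ _ hα.1.ne'] at this ⊢
      linarith
    · simpa [energyOfMomentum_zero hε] using hpos0.le
  refine ⟨c, Y c, hc.1.lt_of_ne fun h0 => ?_, hY c hc.1, sub_eq_zero.1 hceq⟩
  rw [← h0, zero_mul, energyOfMomentum_zero hε, sub_zero] at hceq
  exact hpos0.ne' hceq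

theorem IsBackwardSolution.eq_energyOfMomentum (hε : 0 < ε) (hc : 0 ≤ c) (hB : IsTypeB f α)
    (h : IsBackwardSolution f ε c y) (hα : y α = energyOfMomentum ε (c * α)) :
    ∀ v ∈ Icc 0 α, y v = energyOfMomentum ε (c * v) := by
  have hsub : Icc 0 α ⊆ Icc (0 : ℝ) 1 := Icc_subset_Icc_right hB.threshold_mem.2.le
  have hode : ∀ t ∈ Icc 0 α, HasDerivWithinAt y (c * frontSlope ε (max (y t) 0)) (Icc 0 α) t :=
    fun t ht => by simpa only [hB.eq_zero t ht, sub_zero] using (h.ode t (hsub ht)).mono hsub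
  have henergy : ∀ t ∈ Icc 0 α, HasDerivWithinAt (fun v => energyOfMomentum ε (c * v))
      (c * frontSlope ε (max (energyOfMomentum ε (c * t)) 0)) (Icc 0 α) t := by
    intro t ht
    have hct : 0 ≤ c * t := mul_nonneg hc ht.1
    rw [max_eq_left (energyOfMomentum_nonneg hε hct), frontSlope_energyOfMomentum hε hct]
    have hd := (hasDerivAt_energyOfMomentum hε (c * t)).comp t (hasDerivAt_const_mul c)
    exact (hd.congr_deriv (mul_comm _ _)).hasDerivWithinAt
  have hmono := (monotone_frontSlope_max hε le_rfl).const_mul hc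
  intro v hv
  apply le_antisymm
  · simpa using le_add_mul_of_right_le le_rfl henergy hode (fun s _ hs => by simpa using hmono hs)
      hα.le v hv
  · simpa using le_add_mul_of_right_le le_rfl hode henergy (fun s _ hs => by simpa using hmono hs)
      hα.ge v hv

theorem exists_isFirstOrderSolution (hε : 0 < ε) (hH : HypH f) (hB : IsTypeB f α) :
    ∃ c y, IsFirstOrderSolution f ε c y := by
  have hf0 := hB.nonneg hH.map_one
  obtain ⟨c, y, hc, hy, hyα⟩ := exists_isBackwardSolution_eq_energyOfMomentum hε hH hB
  have hyeq := hy.eq_energyOfMomentum hε hc.le hB hyα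
  refine ⟨c, y, fun v hv => ?_, ?_, hy.map_one, fun v hv => ?_⟩
  · have hode := hy.ode v hv
    rwa [max_eq_left (hy.nonneg hf0 v hv)] at hode
  · simpa [energyOfMomentum_zero hε] using hyeq 0 (left_mem_Icc.2 hB.threshold_mem.1.le)
  · rcases le_or_gt v α with hvα | hαv
    · rw [hyeq v ⟨hv.1.le, hvα⟩]
      exact energyOfMomentum_pos hε (mul_pos hc hv.1)
    · exact hy.pos hf0 hv (hB.pos v ⟨hαv, hv.2⟩)

end BackwardSolution

section FirstOrderSolution

variable {f y y' : ℝ → ℝ} {α ε c c' v : ℝ}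

theorem IsFirstOrderSolution.nonneg (h : IsFirstOrderSolution f ε c y) :
    ∀ v ∈ Icc (0 : ℝ) 1, 0 ≤ y v := by
  intro v hv
  rcases hv.1.eq_or_lt with rfl | h0
  · exact h.map_zero.ge
  rcases hv.2.eq_or_lt with rfl | h1
  · exact h.map_one.ge
  · exact (h.pos v ⟨h0, h1⟩).le

theorem IsFirstOrderSolution.hasDerivWithinAt (h : IsFirstOrderSolution f ε c y) :
    ∀ v ∈ Icc (0 : ℝ) 1, HasDerivWithinAt y (c * frontSlope ε (y v) - f v) (Icc 0 1) v := h.ode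

theorem IsFirstOrderSolution.hasDerivAt (h : IsFirstOrderSolution f ε c y) :
    ∀ v ∈ Ioo (0 : ℝ) 1, HasDerivAt y (c * frontSlope ε (y v) - f v) v := fun v hv =>
  (h.ode v (Ioo_subset_Icc_self hv)).hasDerivAt (Icc_mem_nhds hv.1 hv.2)

theorem IsFirstOrderSolution.continuousOn (h : IsFirstOrderSolution f ε c y) :
    ContinuousOn y (Icc 0 1) := fun v hv => (h.ode v hv).continuousWithinAt

theorem IsFirstOrderSolution.hasDerivAt_momentum (hε : 0 < ε) (h : IsFirstOrderSolution f ε c y)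
    (hv : v ∈ Ioo (0 : ℝ) 1) :
    HasDerivAt (fun v => √(y v * (2 * ε + y v))) (c - f v / frontSlope ε (y v)) v := by
  have hy := h.pos v hv
  have hd := h.hasDerivAt v hv
  have hslope := frontSlope_pos hε hy
  have hsqrt : √(y v * (2 * ε + y v)) = frontSlope ε (y v) * (ε + y v) := by
    unfold frontSlope; field_simp
  convert (hd.fun_mul (hd.const_add (2 * ε))).sqrt (by positivity) using 1
  rw [hsqrt]
  field_simp
  ring

theorem IsFirstOrderSolution.momentum_eq (hε : 0 < ε) (hB : IsTypeB f α)
    (h : IsFirstOrderSolution f ε c y) (hv : v ∈ Icc 0 α) :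
    √(y v * (2 * ε + y v)) = c * v := by
  have hα := hB.threshold_mem
  rcases hv.1.eq_or_lt with rfl | hv0
  · simp [h.map_zero]
  have hcont : ContinuousOn (fun v => √(y v * (2 * ε + y v))) (Icc 0 v) := by
    have := h.continuousOn.mono (Icc_subset_Icc_right (hv.2.trans hα.2.le))
    fun_prop
  obtain ⟨x, -, hx⟩ := exists_hasDerivAt_eq_slope _ (fun _ => c) hv0 hcont fun x hx => by
    simpa [hB.eq_zero x ⟨hx.1.le, hx.2.le.trans hv.2⟩] using
      h.hasDerivAt_momentum hε ⟨hx.1, hx.2.trans_le (hv.2.trans hα.2.le)⟩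
  rw [eq_div_iff (by simpa using hv0.ne'), h.map_zero] at hx
  simpa using hx.symm

theorem IsFirstOrderSolution.speed_pos (hε : 0 < ε) (hB : IsTypeB f α)
    (h : IsFirstOrderSolution f ε c y) : 0 < c := by
  have hα := hB.threshold_mem
  have hyα := h.pos α hα
  have hmom : 0 < c * α := h.momentum_eq hε hB (right_mem_Icc.2 hα.1.le) ▸ by positivity
  exact pos_of_mul_pos_left hmom hα.1.le

theorem IsFirstOrderSolution.eq_energyOfMomentum (hε : 0 < ε) (hB : IsTypeB f α)
    (h : IsFirstOrderSolution f ε c y) (hv : v ∈ Icc 0 α) :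
    y v = energyOfMomentum ε (c * v) := by
  rw [← h.momentum_eq hε hB hv,
    energyOfMomentum_sqrt hε (h.nonneg v ⟨hv.1, hv.2.trans hB.threshold_mem.2.le⟩)]

theorem IsFirstOrderSolution.speed_le (hε : 0 < ε) (hB : IsTypeB f α)
    (h : IsFirstOrderSolution f ε c y) (h' : IsFirstOrderSolution f ε c' y') : c' ≤ c := by
  by_contra! hlt
  have hα := hB.threshold_mem
  have hα' : α ∈ Icc 0 α := right_mem_Icc.2 hα.1.le
  have hc := h.speed_pos hε hB
  have hle := le_add_mul_of_right_le le_rfl h.hasDerivWithinAt h'.hasDerivWithinAt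
    (fun v hv hyv => by
      have := monotoneOn_frontSlope hε (h.nonneg v hv) (h'.nonneg v hv) hyv
      have := frontSlope_nonneg hε (h.nonneg v hv)
      nlinarith)
    (h'.map_one.trans_le h.map_one.ge) α (Ioo_subset_Icc_self hα)
  rw [zero_mul, add_zero, h.eq_energyOfMomentum hε hB hα', h'.eq_energyOfMomentum hε hB hα'] at hle
  exact hle.not_gt (strictMonoOn_energyOfMomentum hε (mul_pos hc hα.1).le
    (mul_pos (hc.trans hlt) hα.1).le (mul_lt_mul_of_pos_right hlt hα.1))

theorem setOf_isAdmissibleSpeed_eq (hε : 0 < ε) (hH : HypH f) (hB : IsTypeB f α) :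
    {c : ℝ | IsAdmissibleSpeed f ε c} = {criticalSpeed f ε} := by
  obtain ⟨c, y, h⟩ := exists_isFirstOrderSolution hε hH hB
  have hsingleton : {c : ℝ | IsAdmissibleSpeed f ε c} = {c} :=
    eq_singleton_iff_unique_mem.2 ⟨⟨y, h⟩, fun c' ⟨y', h'⟩ =>
      (h.speed_le hε hB h').antisymm (h'.speed_le hε hB h)⟩
  rw [criticalSpeed, hsingleton, csInf_singleton]

theorem exists_isFirstOrderSolution_criticalSpeed (hε : 0 < ε) (hH : HypH f) (hB : IsTypeB f α) :
    ∃ y, IsFirstOrderSolution f ε (criticalSpeed f ε) y :=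
  (setOf_isAdmissibleSpeed_eq hε hH hB).ge rfl

end FirstOrderSolution

/-! ### Fronts from first-order solutions -/

/-- The time which the flow of `v' = G v` needs to move from `v₀` to `v`. -/
noncomputable def travelTime (G : ℝ → ℝ) (v₀ v : ℝ) : ℝ := ∫ s in v₀..v, (G s)⁻¹

section TravelTime

variable {G : ℝ → ℝ} {a b C v₀ v : ℝ}

theorem hasDerivAt_travelTime (hG : ContinuousOn G (Ioo a b)) (hpos : ∀ v ∈ Ioo a b, 0 < G v)
    (hv₀ : v₀ ∈ Ioo a b) (hv : v ∈ Ioo a b) : HasDerivAt (travelTime G v₀) (G v)⁻¹ v := by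
  have hinv : ContinuousOn (fun s => (G s)⁻¹) (Ioo a b) := hG.inv₀ fun v hv => (hpos v hv).ne'
  exact intervalIntegral.integral_hasDerivAt_right
    (hinv.mono (ordConnected_Ioo.uIcc_subset hv₀ hv)).intervalIntegrable
    (hinv.stronglyMeasurableAtFilter isOpen_Ioo v hv) (hinv.continuousAt (isOpen_Ioo.mem_nhds hv))

theorem strictMonoOn_travelTime (hG : ContinuousOn G (Ioo a b)) (hpos : ∀ v ∈ Ioo a b, 0 < G v)
    (hv₀ : v₀ ∈ Ioo a b) : StrictMonoOn (travelTime G v₀) (Ioo a b) := by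
  have hd := fun v (hv : v ∈ Ioo a b) => hasDerivAt_travelTime hG hpos hv₀ hv
  refine strictMonoOn_of_deriv_pos (convex_Ioo a b)
    (fun v hv => (hd v hv).continuousAt.continuousWithinAt) fun v hv => ?_
  rw [interior_Ioo] at hv
  rw [(hd v hv).deriv]
  exact inv_pos.2 (hpos v hv)

theorem log_sub_log_le_travelTime (hG : ContinuousOn G (Ioo a b)) (hpos : ∀ v ∈ Ioo a b, 0 < G v)
    (hb : ∀ v ∈ Ioo a b, G v ≤ C * (b - v)) (hv₀ : v₀ ∈ Ioo a b) (hv : v ∈ Ico v₀ b) :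
    C⁻¹ * (Real.log (b - v₀) - Real.log (b - v)) ≤ travelTime G v₀ v := by
  have hsub : Icc v₀ v ⊆ Ioo a b := Icc_subset_Ioo hv₀.1 hv.2
  have hlog : ∀ s ∈ Ioo a b, HasDerivAt (fun s => -(C⁻¹ * Real.log (b - s))) (C * (b - s))⁻¹ s :=
    fun s hs => by
      have hbs : b - s ≠ 0 := (sub_pos.2 hs.2).ne'
      refine ((((hasDerivAt_id s).const_sub b).log hbs).const_mul C⁻¹).fun_neg.congr_deriv ?_
      rw [id, mul_inv]
      ring
  have h := sub_le_sub_of_hasDerivWithinAt_le hv.1 subset_rfl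
    (fun s hs => (hlog s (hsub hs)).hasDerivWithinAt)
    (fun s hs => (hasDerivAt_travelTime hG hpos hv₀ (hsub hs)).hasDerivWithinAt) fun s hs => by
      have hs := hsub (Ioo_subset_Icc_self hs)
      exact inv_anti₀ (hpos s hs) (hb s hs)
  have hzero : travelTime G v₀ v₀ = 0 := intervalIntegral.integral_same
  linarith

theorem tendsto_travelTime_right (hG : ContinuousOn G (Ioo a b)) (hpos : ∀ v ∈ Ioo a b, 0 < G v)
    (hC : 0 < C) (hb : ∀ v ∈ Ioo a b, G v ≤ C * (b - v)) (hv₀ : v₀ ∈ Ioo a b) :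
    Tendsto (travelTime G v₀) (𝓝[<] b) atTop := by
  have hsub : Tendsto (fun v => b - v) (𝓝[<] b) (𝓝[>] 0) := by
    refine tendsto_nhdsWithin_iff.2 ⟨?_, ?_⟩
    · have : Tendsto (fun v => b - v) (𝓝 b) (𝓝 (b - b)) := (tendsto_const_nhds).sub tendsto_id
      exact (sub_self b ▸ this).mono_left nhdsWithin_le_nhds
    · filter_upwards [self_mem_nhdsWithin] with v hv using sub_pos.2 (mem_Iio.1 hv)
  have hlog : Tendsto (fun v => C⁻¹ * (Real.log (b - v₀) - Real.log (b - v))) (𝓝[<] b) atTop :=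
    (tendsto_atTop_add_const_left _ _ (tendsto_neg_atBot_atTop.comp
      (Real.tendsto_log_nhdsGT_zero.comp hsub))).const_mul_atTop (inv_pos.2 hC)
  refine tendsto_atTop_mono' _ ?_ hlog
  filter_upwards [Ico_mem_nhdsLT hv₀.2] with v hv using
    log_sub_log_le_travelTime hG hpos hb hv₀ hv

theorem travelTime_comp_neg (G : ℝ → ℝ) (v₀ v : ℝ) :
    travelTime (fun s => G (-s)) (-v₀) (-v) = -travelTime G v₀ v := by
  unfold travelTime
  rw [intervalIntegral.integral_comp_neg fun s => (G s)⁻¹, neg_neg, neg_neg,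
    intervalIntegral.integral_symm]

theorem tendsto_travelTime_left (hG : ContinuousOn G (Ioo a b)) (hpos : ∀ v ∈ Ioo a b, 0 < G v)
    (hC : 0 < C) (ha : ∀ v ∈ Ioo a b, G v ≤ C * (v - a)) (hv₀ : v₀ ∈ Ioo a b) :
    Tendsto (travelTime G v₀) (𝓝[>] a) atBot := by
  have hneg : ∀ s ∈ Ioo (-b) (-a), -s ∈ Ioo a b := fun s hs =>
    ⟨lt_neg.2 hs.2, neg_lt.2 hs.1⟩
  have h := tendsto_travelTime_right (G := fun s => G (-s)) (v₀ := -v₀)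
    (hG.comp continuousOn_neg hneg) (fun s hs => hpos _ (hneg s hs)) hC
    (fun s hs => (ha _ (hneg s hs)).trans_eq (by ring))
    ⟨neg_lt_neg hv₀.2, neg_lt_neg hv₀.1⟩
  exact tendsto_neg_atTop_iff.1
    ((h.comp tendsto_neg_nhdsGT).congr fun v => travelTime_comp_neg G v₀ v)

theorem surjOn_travelTime (hG : ContinuousOn G (Ioo a b)) (hpos : ∀ v ∈ Ioo a b, 0 < G v)
    (hC : 0 < C) (ha : ∀ v ∈ Ioo a b, G v ≤ C * (v - a)) (hb : ∀ v ∈ Ioo a b, G v ≤ C * (b - v))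
    (hv₀ : v₀ ∈ Ioo a b) : SurjOn (travelTime G v₀) (Ioo a b) univ := by
  have hab : a < b := hv₀.1.trans hv₀.2
  refine ContinuousOn.surjOn_of_tendsto ⟨v₀, hv₀⟩
    (fun v hv => (hasDerivAt_travelTime hG hpos hv₀ hv).continuousAt.continuousWithinAt) ?_ ?_
  · exact (tendsto_comp_coe_Ioo_atBot hab).2 (tendsto_travelTime_left hG hpos hC ha hv₀)
  · exact (tendsto_comp_coe_Ioo_atTop hab).2 (tendsto_travelTime_right hG hpos hC hb hv₀)

/-- The orbit is the inverse function of the travel time. -/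
theorem exists_heteroclinic_orbit (z₀ : ℝ) (hG : ContinuousOn G (Ioo a b))
    (hpos : ∀ v ∈ Ioo a b, 0 < G v) (hC : 0 < C) (ha : ∀ v ∈ Ioo a b, G v ≤ C * (v - a))
    (hb : ∀ v ∈ Ioo a b, G v ≤ C * (b - v)) (hv₀ : v₀ ∈ Ioo a b) :
    ∃ v : ℝ → ℝ, (∀ z, v z ∈ Ioo a b) ∧ (∀ z, HasDerivAt v (G (v z)) z) ∧ v z₀ = v₀ ∧
      Tendsto v atBot (𝓝 a) ∧ Tendsto v atTop (𝓝 b) := by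
  have hab : a < b := hv₀.1.trans hv₀.2
  have hT := strictMonoOn_travelTime hG hpos hv₀
  choose V hV hTV using fun z : ℝ =>
    surjOn_travelTime hG hpos hC ha hb hv₀ (mem_univ (z - z₀))
  have hVT : ∀ v ∈ Ioo a b, V (z₀ + travelTime G v₀ v) = v := fun v hv =>
    hT.injOn (hV _) hv ((hTV _).trans (add_sub_cancel_left _ _))
  have hVmono : Monotone V := fun z w hzw => by
    rw [← hT.le_iff_le (hV z) (hV w), hTV, hTV]
    exact sub_le_sub_right hzw z₀
  have hrange : range V = Ioo a b :=
    (range_subset_iff.2 hV).antisymm fun v hv => ⟨_, hVT v hv⟩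
  have hVcont : ∀ z, ContinuousAt V z := fun z => by
    refine continuousAt_of_monotoneOn_of_image_mem_nhds (hVmono.monotoneOn univ) univ_mem ?_
    rw [image_univ, hrange]
    exact isOpen_Ioo.mem_nhds (hV z)
  refine ⟨V, hV, fun z => ?_, ?_, ?_, ?_⟩
  · have := HasDerivAt.of_local_left_inverse (hVcont z)
      ((hasDerivAt_travelTime hG hpos hv₀ (hV z)).const_add z₀) (inv_pos.2 (hpos _ (hV z))).ne'
      (Eventually.of_forall fun z => by rw [hTV, add_sub_cancel])
    rwa [inv_inv] at this
  · simpa [travelTime] using hVT v₀ hv₀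
  · exact tendsto_atBot_isGLB hVmono (hrange ▸ isGLB_Ioo hab)
  · exact tendsto_atTop_isLUB hVmono (hrange ▸ isLUB_Ioo hab)

end TravelTime

section ExistsFront

variable {f y : ℝ → ℝ} {α ε c v : ℝ}

theorem IsFirstOrderSolution.frontSlope_le_mul (hε : 0 < ε) (hH : HypH f) (hB : IsTypeB f α)
    (h : IsFirstOrderSolution f ε c y) (hv : v ∈ Ioo (0 : ℝ) 1) :
    frontSlope ε (y v) ≤ c / ε * v := by
  have hc := h.speed_pos hε hB
  have hsub : Icc 0 v ⊆ Icc 0 1 := Icc_subset_Icc_right hv.2.le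
  obtain ⟨x, hx, hxv⟩ := exists_hasDerivAt_eq_slope (fun v => √(y v * (2 * ε + y v)))
    (fun v => c - f v / frontSlope ε (y v)) hv.1
    (by have := h.continuousOn.mono hsub; fun_prop)
    fun x hx => h.hasDerivAt_momentum hε ⟨hx.1, hx.2.trans hv.2⟩
  have hx01 : x ∈ Icc (0 : ℝ) 1 := hsub (Ioo_subset_Icc_self hx)
  have hmom : √(y v * (2 * ε + y v)) ≤ c * v := by
    have := div_nonneg (hB.nonneg hH.map_one x hx01) (frontSlope_nonneg hε (h.nonneg x hx01))
    rw [eq_div_iff (by simpa using hv.1.ne')] at hxv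
    simp only [h.map_zero, zero_mul, Real.sqrt_zero, sub_zero] at hxv
    nlinarith [hv.1]
  calc frontSlope ε (y v) ≤ c * v / (ε + y v) := by
        have := h.pos v hv
        unfold frontSlope
        gcongr
    _ ≤ c * v / ε := by
        have := mul_pos hc hv.1
        have := h.pos v hv
        gcongr
        linarith
    _ = c / ε * v := by ring

theorem IsFirstOrderSolution.le_mul_one_sub_sq (hε : 0 < ε) (hc : 0 ≤ c) {k : ℝ}
    (hk : ∀ s ∈ Icc (0 : ℝ) 1, |f s| ≤ k * (1 - s)) (h : IsFirstOrderSolution f ε c y)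
    (hv : v ∈ Icc (0 : ℝ) 1) : y v ≤ k / 2 * (1 - v) ^ 2 := by
  have hsub : Icc v 1 ⊆ Icc 0 1 := Icc_subset_Icc_left hv.1
  have hd : ∀ s ∈ Icc v 1,
      HasDerivWithinAt (fun s => k / 2 * (1 - s) ^ 2) (-(k * (1 - s))) (Icc 0 1) s :=
    fun s _ => by
      refine ((((hasDerivWithinAt_id s (Icc 0 1)).const_sub 1).fun_pow 2).const_mul
        (k / 2)).congr_deriv ?_
      simp only [id, Nat.cast_ofNat, Nat.reduceSub, pow_one]
      ring
  have := sub_le_sub_of_hasDerivWithinAt_le hv.2 hsub hd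
    (fun s hs => h.hasDerivWithinAt s (hsub hs)) fun s hs => by
      have hs := hsub (Ioo_subset_Icc_self hs)
      have := (le_abs_self _).trans (hk s hs)
      have := mul_nonneg hc (frontSlope_nonneg hε (h.nonneg s hs))
      linarith
  simp only [h.map_one, sub_self, ne_eq, OfNat.ofNat_ne_zero, not_false_eq_true, zero_pow,
    mul_zero] at this
  linarith

theorem IsFirstOrderSolution.frontSlope_le_mul_one_sub (hε : 0 < ε) (hc : 0 ≤ c) {k : ℝ}
    (hk0 : 0 ≤ k) (hk : ∀ s ∈ Icc (0 : ℝ) 1, |f s| ≤ k * (1 - s))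
    (h : IsFirstOrderSolution f ε c y) (hv : v ∈ Icc (0 : ℝ) 1) :
    frontSlope ε (y v) ≤ √(k / ε) * (1 - v) := by
  refine le_of_sq_le_sq ?_ (mul_nonneg (Real.sqrt_nonneg _) (sub_nonneg.2 hv.2))
  calc frontSlope ε (y v) ^ 2 ≤ 2 * (y v / ε) := by
        simpa [frontSlope_zero] using frontSlope_sq_sub_le hε le_rfl (h.nonneg v hv)
    _ ≤ 2 * (k / 2 * (1 - v) ^ 2 / ε) := by
        gcongr
        exact h.le_mul_one_sub_sq hε hc hk hv
    _ = (√(k / ε) * (1 - v)) ^ 2 := by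
        rw [mul_pow, Real.sq_sqrt (by positivity)]
        ring

theorem IsFirstOrderSolution.isFront (hε : 0 < ε) (h : IsFirstOrderSolution f ε c y) {V : ℝ → ℝ}
    (hV : ∀ z, V z ∈ Ioo (0 : ℝ) 1) (hd : ∀ z, HasDerivAt V (frontSlope ε (y (V z))) z)
    (hbot : Tendsto V atBot (𝓝 0)) (htop : Tendsto V atTop (𝓝 1)) : IsFront f ε c V := by
  have hderiv : ∀ z, deriv V z = frontSlope ε (y (V z)) := fun z => (hd z).deriv
  have hy : ∀ z, 0 < y (V z) := fun z => h.pos _ (hV z)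
  have hmom : (fun z => ε * (deriv V z / √(1 - deriv V z ^ 2))) =
      fun z => √(y (V z) * (2 * ε + y (V z))) := funext fun z => by
    rw [hderiv, momentum_frontSlope hε (hy z).le]
  refine ⟨?_, fun z => (hd z).differentiableAt, fun z => ?_, fun z => ?_, hbot, htop⟩
  · exact monotone_of_hasDerivAt_nonneg hd fun z => frontSlope_nonneg hε (hy z).le
  · rw [hderiv, abs_of_nonneg (frontSlope_nonneg hε (hy z).le)]
    exact frontSlope_lt_one hε (hy z).le
  · rw [hmom, hderiv]
    refine ((h.hasDerivAt_momentum hε (hV z)).comp z (hd z)).congr_deriv ?_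
    rw [sub_mul, div_mul_cancel₀ _ (frontSlope_pos hε (hy z)).ne']

theorem IsFirstOrderSolution.exists_isFront (hε : 0 < ε) (hH : HypH f) (hB : IsTypeB f α)
    (h : IsFirstOrderSolution f ε c y) {v₀ : ℝ} (hv₀ : v₀ ∈ Ioo (0 : ℝ) 1) :
    ∃ V : ℝ → ℝ, IsFront f ε c V ∧ V 0 = v₀ ∧
      ∀ z, HasDerivAt V (frontSlope ε (y (V z))) z := by
  have hc := h.speed_pos hε hB
  obtain ⟨k, hk, hfk⟩ := hH.linear_control
  have hC : 0 < c / ε + √(k / ε) := by positivity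
  obtain ⟨V, hV, hd, h0, hbot, htop⟩ := exists_heteroclinic_orbit
    (G := fun v => frontSlope ε (y v)) 0
    ((continuousOn_frontSlope hε).comp (h.continuousOn.mono Ioo_subset_Icc_self)
      fun v hv => (h.pos v hv).le)
    (fun v hv => frontSlope_pos hε (h.pos v hv)) hC
    (fun v hv => by
      have := mul_nonneg (Real.sqrt_nonneg (k / ε)) hv.1.le
      linarith [h.frontSlope_le_mul hε hH hB hv])
    (fun v hv => by
      have := mul_nonneg (div_pos hc hε).le (sub_nonneg.2 hv.2.le)
      linarith [h.frontSlope_le_mul_one_sub hε hc.le hk.le (fun s hs => (hfk s hs).2)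
        (Ioo_subset_Icc_self hv)])
    hv₀
  exact ⟨V, h.isFront hε hV hd hbot htop, h0, hd⟩

end ExistsFront

/-! ### Uniqueness of the critical front -/

/-- The momentum `ε v' / √(1 - v'²)` of the profile `v` at `z`. -/
noncomputable def frontMomentum (ε : ℝ) (v : ℝ → ℝ) (z : ℝ) : ℝ :=
  ε * (deriv v z / √(1 - deriv v z ^ 2))

/-- The vector field of the front equation, written as a first-order system for the profile and
its momentum. -/
noncomputable def phaseField (f : ℝ → ℝ) (ε c : ℝ) (x : ℝ × ℝ) : ℝ × ℝ :=
  (slopeOfMomentum ε x.2, c * slopeOfMomentum ε x.2 - f x.1)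

section FrontUniqueness

variable {f v w y : ℝ → ℝ} {α ε c z : ℝ} {K : NNReal}

theorem exists_lipschitzOnWith_of_isTypeB (hB : IsTypeB f α)
    (hf : LocallyLipschitzOn (Icc α 1) f) : ∃ K, LipschitzOnWith K f (Icc 0 1) := by
  have hα := hB.threshold_mem
  obtain ⟨K, hK⟩ := hf.exists_lipschitzOnWith_of_compact isCompact_Icc
  have hmax : EqOn f (fun x => f (max x α)) (Icc 0 1) := fun x hx => by
    rcases le_total x α with h | h
    · simp only [max_eq_right h, hB.eq_zero x ⟨hx.1, h⟩, hB.eq_zero α ⟨hα.1.le, le_rfl⟩]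
    · simp only [max_eq_left h]
  have hmaps : MapsTo (fun x => max x α) (Icc 0 1) (Icc α 1) := fun x hx =>
    ⟨le_max_right _ _, max_le hx.2 hα.2.le⟩
  have hcomp := hK.comp (LipschitzWith.id.max_const α).lipschitzOnWith hmaps
  refine ⟨K * 1, fun x hx y hy => ?_⟩
  rw [hmax hx, hmax hy]
  exact hcomp hx hy

theorem exists_lipschitzOnWith_phaseField (hε : 0 < ε) (c : ℝ)
    (hf : LipschitzOnWith K f (Icc 0 1)) :
    ∃ L, LipschitzOnWith L (phaseField f ε c) (Icc 0 1 ×ˢ univ) := by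
  have hslope := ((lipschitzWith_slopeOfMomentum hε).comp
    (LipschitzWith.prod_snd (α := ℝ) (β := ℝ))).lipschitzOnWith (s := Icc 0 1 ×ˢ univ)
  have hreaction := hf.comp (LipschitzWith.prod_fst (α := ℝ) (β := ℝ)).lipschitzOnWith
    (mapsTo_fst_prod (s := Icc (0 : ℝ) 1) (t := univ))
  exact ⟨_, hslope.prodMk (((lipschitzWith_smul c).comp_lipschitzOnWith hslope).sub hreaction)⟩

theorem IsFront.mem_Icc (h : IsFront f ε c v) (z : ℝ) : v z ∈ Icc (0 : ℝ) 1 :=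
  ⟨h.monotone.le_of_tendsto h.tendsto_atBot z, h.monotone.ge_of_tendsto h.tendsto_atTop z⟩

theorem IsFront.slopeOfMomentum_frontMomentum (hε : 0 < ε) (h : IsFront f ε c v) (z : ℝ) :
    slopeOfMomentum ε (frontMomentum ε v z) = deriv v z := by
  have hpos : 0 < 1 - deriv v z ^ 2 :=
    sub_pos.2 ((sq_lt_one_iff_abs_lt_one _).2 (h.slope_lt_one z))
  have hsq : ε ^ 2 + frontMomentum ε v z ^ 2 = (ε / √(1 - deriv v z ^ 2)) ^ 2 := by
    have := Real.sq_sqrt hpos.le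
    unfold frontMomentum
    field_simp
    rw [this]
    ring
  rw [slopeOfMomentum, hsq, Real.sqrt_sq (by positivity), frontMomentum]
  field_simp

theorem IsFront.hasDerivAt_phaseField (hε : 0 < ε) (h : IsFront f ε c v) (z : ℝ) :
    HasDerivAt (fun z => (v z, frontMomentum ε v z))
      (phaseField f ε c (v z, frontMomentum ε v z)) z := by
  unfold phaseField
  rw [h.slopeOfMomentum_frontMomentum hε]
  exact (h.differentiable z).hasDerivAt.prodMk (h.ode z)

theorem IsFront.frontMomentum_eq (hε : 0 < ε) (hB : IsTypeB f α) (h : IsFront f ε c v)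
    (hz : v z ≤ α) : frontMomentum ε v z = c * v z := by
  have hd : ∀ s ≤ z, HasDerivAt (fun s => frontMomentum ε v s - c * v s) 0 s := fun s hs => by
    have hfs := hB.eq_zero (v s) ⟨(h.mem_Icc s).1, (h.monotone hs).trans hz⟩
    refine ((h.ode s).fun_sub ((h.differentiable s).hasDerivAt.const_mul c)).congr_deriv ?_
    rw [hfs, sub_zero, sub_self]
  set k := frontMomentum ε v z - c * v z
  have hconst : ∀ s ≤ z, frontMomentum ε v s = c * v s + k := fun s hs => by
    have := constant_of_has_deriv_right_zero
      (fun x hx => (hd x hx.2).continuousAt.continuousWithinAt)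
      (fun x hx => (hd x hx.2.le).hasDerivWithinAt) z (right_mem_Icc.2 hs)
    linarith
  have hmom : Tendsto (frontMomentum ε v) atBot (𝓝 k) := by
    have := (h.tendsto_atBot.const_mul c).add_const k
    rw [mul_zero, zero_add] at this
    refine this.congr' ?_
    filter_upwards [eventually_le_atBot z] with s hs using (hconst s hs).symm
  have hderiv : Tendsto (deriv v) atBot (𝓝 (slopeOfMomentum ε k)) :=
    (((lipschitzWith_slopeOfMomentum hε).continuous.tendsto k).comp hmom).congr
      (h.slopeOfMomentum_frontMomentum hε)
  have hzero := eq_zero_of_tendsto_atBot_of_tendsto_deriv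
    (fun z => (h.differentiable z).hasDerivAt) h.tendsto_atBot hderiv
  exact sub_eq_zero.1 ((slopeOfMomentum_eq_zero_iff hε).1 hzero)

theorem IsFront.unique (hε : 0 < ε) (hB : IsTypeB f α) (hf : LipschitzOnWith K f (Icc 0 1))
    (hv : IsFront f ε c v) (hw : IsFront f ε c w) (hvw : v z = w z) (hz : v z ≤ α) : v = w := by
  obtain ⟨L, hL⟩ := exists_lipschitzOnWith_phaseField hε c hf
  have hsame : (v z, frontMomentum ε v z) = (w z, frontMomentum ε w z) := by
    rw [hv.frontMomentum_eq hε hB hz, hw.frontMomentum_eq hε hB (hvw ▸ hz), hvw]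
  have heq := ODE_solution_unique_univ (t₀ := z) (fun _ => hL)
    (fun t => ⟨hv.hasDerivAt_phaseField hε t, hv.mem_Icc t, trivial⟩)
    (fun t => ⟨hw.hasDerivAt_phaseField hε t, hw.mem_Icc t, trivial⟩) hsame
  exact funext fun t => congrArg Prod.fst (congrFun heq t)

theorem existsUnique_isCriticalFront (hε : 0 < ε) (hH : HypH f) (hB : IsTypeB f α)
    (hf : LipschitzOnWith K f (Icc 0 1)) : ∃! v : ℝ → ℝ, IsCriticalFront f α ε v := by
  obtain ⟨y, hy⟩ := exists_isFirstOrderSolution_criticalSpeed hε hH hB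
  obtain ⟨v, hv, hv0, -⟩ := hy.exists_isFront hε hH hB hB.threshold_mem
  exact ⟨v, ⟨hv, hv0⟩, fun w hw => hw.1.unique hε hB hf hv (hw.2.trans hv0.symm) hw.2.le⟩

theorem IsCriticalFront.hasDerivAt (hε : 0 < ε) (hH : HypH f) (hB : IsTypeB f α)
    (hf : LipschitzOnWith K f (Icc 0 1)) (hv : IsCriticalFront f α ε v)
    (hy : IsFirstOrderSolution f ε (criticalSpeed f ε) y) (z : ℝ) :
    HasDerivAt v (frontSlope ε (y (v z))) z := by
  obtain ⟨w, hw, hw0, hd⟩ := hy.exists_isFront hε hH hB hB.threshold_mem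
  rw [(existsUnique_isCriticalFront hε hH hB hf).unique hv ⟨hw, hw0⟩]
  exact hd z

end FrontUniqueness

/-! ### The tangency level -/

section Unimodal

variable {f : ℝ → ℝ} {p q m : ℝ}

theorem strictMonoOn_of_unique_isLocalMaxOn (hf : ContinuousOn f (Icc p q)) (hm : m ≤ q)
    (h : ∀ x ∈ Icc p q, IsLocalMaxOn f (Icc p q) x → x = m) : StrictMonoOn f (Icc p m) := by
  intro x hx w hw hxw
  by_contra! hle
  have hwq : w ≤ q := hw.2.trans hm
  obtain ⟨t, ht, htw, hmax⟩ : ∃ t ∈ Icc p w, t < w ∧ IsMaxOn f (Icc p w) t := by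
    obtain ⟨t, ht, hmax⟩ := isCompact_Icc.exists_isMaxOn (nonempty_Icc.2 hw.1)
      (hf.mono (Icc_subset_Icc_right hwq))
    rcases ht.2.lt_or_eq with htw | rfl
    · exact ⟨t, ht, htw, hmax⟩
    · exact ⟨x, ⟨hx.1, hxw.le⟩, hxw, fun s hs => (hmax hs).trans hle⟩
  have htm : t = m := h t ⟨ht.1, ht.2.trans hwq⟩ (by
    filter_upwards [self_mem_nhdsWithin, nhdsWithin_le_nhds (Iio_mem_nhds htw)] with s hs hsw
    exact hmax ⟨hs.1, hsw.le⟩)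
  exact (htw.trans_le hw.2).ne htm

theorem strictAntiOn_of_unique_isLocalMaxOn (hf : ContinuousOn f (Icc p q)) (hm : p ≤ m)
    (h : ∀ x ∈ Icc p q, IsLocalMaxOn f (Icc p q) x → x = m) : StrictAntiOn f (Icc m q) := by
  intro w hw x hx hwx
  by_contra! hle
  have hpw : p ≤ w := hm.trans hw.1
  obtain ⟨t, ht, hwt, hmax⟩ : ∃ t ∈ Icc w q, w < t ∧ IsMaxOn f (Icc w q) t := by
    obtain ⟨t, ht, hmax⟩ := isCompact_Icc.exists_isMaxOn (nonempty_Icc.2 hw.2)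
      (hf.mono (Icc_subset_Icc_left hpw))
    rcases ht.1.lt_or_eq with hwt | rfl
    · exact ⟨t, ht, hwt, hmax⟩
    · exact ⟨x, ⟨hwx.le, hx.2⟩, hwx, fun s hs => (hmax hs).trans hle⟩
  have htm : t = m := h t ⟨hpw.trans ht.1, ht.2⟩ (by
    filter_upwards [self_mem_nhdsWithin, nhdsWithin_le_nhds (Ioi_mem_nhds hwt)] with s hs hws
    exact hmax ⟨hws.le, hs.2⟩)
  exact (hw.1.trans_lt hwt).ne' htm

end Unimodal

section TangencyLevel

variable {f : ℝ → ℝ} {α m vp v : ℝ}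

theorem continuousOn_reactionPrimitive (hf : ContinuousOn f (Icc 0 1)) :
    ContinuousOn (reactionPrimitive f) (Icc 0 1) := fun v hv =>
  (hasDerivWithinAt_reactionPrimitive hf v hv).continuousWithinAt

theorem IsTypeB.reactionPrimitive_eq_zero (hB : IsTypeB f α) (hv : v ∈ Icc 0 α) :
    reactionPrimitive f v = 0 := by
  have hzero : EqOn f (fun _ => 0) (uIcc 0 v) := by
    rw [uIcc_of_le hv.1]
    exact fun s hs => hB.eq_zero s ⟨hs.1, hs.2.trans hv.2⟩
  rw [reactionPrimitive, intervalIntegral.integral_congr hzero, intervalIntegral.integral_zero]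

theorem IsTypeB.reactionPrimitive_one_pos (hB : IsTypeB f α) (hf : ContinuousOn f (Icc 0 1)) :
    0 < reactionPrimitive f 1 := by
  have hα := hB.threshold_mem
  have hmono : StrictMonoOn (reactionPrimitive f) (Icc α 1) := by
    refine strictMonoOn_of_hasDerivWithinAt_pos (f' := f) (convex_Icc α 1)
      ((continuousOn_reactionPrimitive hf).mono (Icc_subset_Icc_left hα.1.le)) ?_ ?_ <;>
      rw [interior_Icc]
    · exact fun v hv => (hasDerivWithinAt_reactionPrimitive hf v
        ⟨(hα.1.trans hv.1).le, hv.2.le⟩).mono fun s hs => ⟨(hα.1.trans hs.1).le, hs.2.le⟩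
    · exact hB.pos
  rw [← hB.reactionPrimitive_eq_zero (right_mem_Icc.2 hα.1.le)]
  exact hmono (left_mem_Icc.2 hα.2.le) (right_mem_Icc.2 hα.2.le) hα.2

/-- The difference `v f(v) - F(v)`: its zeros are the levels at which the line from the origin is
tangent to the graph of `F`, and its sign is that of the derivative of the chord slope
`F(v) / v`. -/
noncomputable def chordExcess (f : ℝ → ℝ) (v : ℝ) : ℝ := v * f v - reactionPrimitive f v

theorem continuousOn_chordExcess (hf : ContinuousOn f (Icc 0 1)) :
    ContinuousOn (chordExcess f) (Icc 0 1) :=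
  (continuousOn_id.mul hf).sub (continuousOn_reactionPrimitive hf)

theorem chordExcess_strictAntiOn (hf : ContinuousOn f (Icc 0 1)) (hm : 0 < m)
    (hanti : StrictAntiOn f (Icc m 1)) : StrictAntiOn (chordExcess f) (Icc m 1) := by
  intro v hv w hw hvw
  have hprim := mul_sub_le_reactionPrimitive_sub (p := f w) hf (hm.le.trans hv.1) hvw.le hw.2
    fun s hs => (hanti ⟨hv.1.trans hs.1.le, hs.2.le.trans hw.2⟩ hw hs.2).le
  have hfvw := mul_lt_mul_of_pos_left (hanti hv hw hvw) (hm.trans_le hv.1)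
  unfold chordExcess
  linarith

theorem IsTypeB.chordExcess_pos (hB : IsTypeB f α) (hf : ContinuousOn f (Icc 0 1)) (hm : m < 1)
    (hmono : StrictMonoOn f (Icc α m)) (hv : v ∈ Ioc α m) : 0 < chordExcess f v := by
  have hα := hB.threshold_mem
  have hprim := reactionPrimitive_sub_le_mul_sub (p := f v) hf hα.1.le hv.1.le
    (hv.2.trans hm.le) fun s hs =>
      (hmono ⟨hs.1.le, hs.2.le.trans hv.2⟩ (Ioc_subset_Icc_self hv) hs.2).le
  rw [hB.reactionPrimitive_eq_zero (right_mem_Icc.2 hα.1.le)] at hprim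
  have := mul_pos hα.1 (hB.pos v ⟨hv.1, hv.2.trans_lt hm⟩)
  unfold chordExcess
  linarith

/-- `f` increases on `[α, m]` and decreases on `[m, 1]`, and `vp` is the level on the decreasing
branch at which the line from the origin is tangent to the graph of the primitive of `f`. -/
structure IsTangencyLevel (f : ℝ → ℝ) (α m vp : ℝ) : Prop where
  argmax_mem : m ∈ Ioo α 1
  strictMonoOn : StrictMonoOn f (Icc α m)
  strictAntiOn : StrictAntiOn f (Icc m 1)
  mem_Ioo : vp ∈ Ioo m 1
  eq_mul : reactionPrimitive f vp = vp * f vp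

theorem exists_isTangencyLevel (hH : HypH f) (hB : IsTypeB f α) (hF : HypFOn f α 1) :
    ∃ m vp, IsTangencyLevel f α m vp := by
  have hα := hB.threshold_mem
  obtain ⟨m, hm, huniq⟩ := hF.unique_localMax
  have hfα : ContinuousOn f (Icc α 1) := hH.continuousOn.mono (Icc_subset_Icc_left hα.1.le)
  have hmono := strictMonoOn_of_unique_isLocalMaxOn hfα hm.2.le fun x hx => (huniq x hx).1
  have hanti := strictAntiOn_of_unique_isLocalMaxOn hfα hm.1.le fun x hx => (huniq x hx).1
  have hpos := hB.chordExcess_pos hH.continuousOn hm.2 hmono (right_mem_Ioc.2 hm.1)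
  have hneg : chordExcess f 1 < 0 := by
    have := hB.reactionPrimitive_one_pos hH.continuousOn
    rw [chordExcess, hH.map_one]
    linarith
  obtain ⟨vp, hvp, hzero⟩ := intermediate_value_Ioo' hm.2.le
    ((continuousOn_chordExcess hH.continuousOn).mono
      (Icc_subset_Icc_left (hα.1.trans hm.1).le)) ⟨hneg, hpos⟩
  exact ⟨m, vp, hm, hmono, hanti, hvp, (sub_eq_zero.1 hzero).symm⟩

theorem IsTangencyLevel.threshold_lt (hvp : IsTangencyLevel f α m vp) : α < vp :=
  hvp.argmax_mem.1.trans hvp.mem_Ioo.1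

theorem IsTangencyLevel.argmax_pos (hB : IsTypeB f α) (hvp : IsTangencyLevel f α m vp) : 0 < m :=
  hB.threshold_mem.1.trans hvp.argmax_mem.1

theorem IsTangencyLevel.mem_Ioo_zero_one (hB : IsTypeB f α) (hvp : IsTangencyLevel f α m vp) :
    vp ∈ Ioo 0 1 := ⟨(hvp.argmax_pos hB).trans hvp.mem_Ioo.1, hvp.mem_Ioo.2⟩

theorem IsTangencyLevel.pos (hB : IsTypeB f α) (hvp : IsTangencyLevel f α m vp) : 0 < f vp :=
  hB.pos vp ⟨hvp.threshold_lt, hvp.mem_Ioo.2⟩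

theorem IsTangencyLevel.isGreatest (hf : ContinuousOn f (Icc 0 1)) (hB : IsTypeB f α)
    (hvp : IsTangencyLevel f α m vp) :
    IsGreatest {v : ℝ | v ∈ Icc (0 : ℝ) 1 ∧ reactionPrimitive f v = v * f v} vp := by
  refine ⟨⟨Ioo_subset_Icc_self (hvp.mem_Ioo_zero_one hB), hvp.eq_mul⟩, fun v ⟨hv, heq⟩ => ?_⟩
  by_contra! hlt
  have hvp0 := hvp.mem_Ioo.1.le
  refine (chordExcess_strictAntiOn hf (hvp.argmax_pos hB) hvp.strictAntiOn
    ⟨hvp0, hvp.mem_Ioo.2.le⟩ ⟨hvp0.trans hlt.le, hv.2⟩ hlt).ne ?_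
  rw [chordExcess, chordExcess, heq, hvp.eq_mul, sub_self, sub_self]

theorem IsTangencyLevel.chordExcess_pos (hf : ContinuousOn f (Icc 0 1)) (hB : IsTypeB f α)
    (hvp : IsTangencyLevel f α m vp) (hv : v ∈ Ioo α vp) : 0 < chordExcess f v := by
  rcases le_or_gt v m with hvm | hmv
  · exact hB.chordExcess_pos hf hvp.argmax_mem.2 hvp.strictMonoOn ⟨hv.1, hvm⟩
  · have hzero : chordExcess f vp = 0 := sub_eq_zero.2 hvp.eq_mul.symm
    exact hzero ▸ chordExcess_strictAntiOn hf (hvp.argmax_pos hB) hvp.strictAntiOn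
      ⟨hmv.le, (hv.2.trans hvp.mem_Ioo.2).le⟩ ⟨hvp.mem_Ioo.1.le, hvp.mem_Ioo.2.le⟩ hv.2

theorem IsTangencyLevel.strictMonoOn_chordSlope (hf : ContinuousOn f (Icc 0 1)) (hB : IsTypeB f α)
    (hvp : IsTangencyLevel f α m vp) :
    StrictMonoOn (fun v => reactionPrimitive f v / v) (Icc α vp) := by
  have hα := hB.threshold_mem
  have hsub : Icc α vp ⊆ Icc 0 1 := Icc_subset_Icc hα.1.le hvp.mem_Ioo.2.le
  have hd : ∀ v ∈ Icc α vp, HasDerivWithinAt (fun v => reactionPrimitive f v / v)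
      ((f v * v - reactionPrimitive f v * 1) / v ^ 2) (Icc α vp) v := fun v hv =>
    ((hasDerivWithinAt_reactionPrimitive hf v (hsub hv)).mono hsub).fun_div
      (hasDerivWithinAt_id v _) (hα.1.trans_le hv.1).ne'
  refine strictMonoOn_of_hasDerivWithinAt_pos (convex_Icc α vp)
    (fun v hv => (hd v hv).continuousWithinAt)
    (fun v hv => (hd v (interior_subset hv)).mono interior_subset) fun v hv => ?_
  rw [interior_Icc] at hv
  have hexcess := hvp.chordExcess_pos hf hB hv
  have := hα.1.trans hv.1
  rw [mul_comm, mul_one]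
  exact div_pos hexcess (by positivity)

theorem IsTangencyLevel.lt_mul (hf : ContinuousOn f (Icc 0 1)) (hB : IsTypeB f α)
    (hvp : IsTangencyLevel f α m vp) (hv : v ∈ Ioo 0 vp) : reactionPrimitive f v < f vp * v := by
  rcases le_or_gt v α with hvα | hαv
  · rw [hB.reactionPrimitive_eq_zero ⟨hv.1.le, hvα⟩]
    exact mul_pos (hvp.pos hB) hv.1
  · have hchord : reactionPrimitive f v / v < reactionPrimitive f vp / vp :=
      hvp.strictMonoOn_chordSlope hf hB ⟨hαv.le, hv.2.le⟩
        (right_mem_Icc.2 hvp.threshold_lt.le) hv.2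
    rw [hvp.eq_mul, mul_div_cancel_left₀ _ (hv.1.trans hv.2).ne'] at hchord
    exact (div_lt_iff₀ hv.1).1 hchord

theorem IsTangencyLevel.le_mul (hf : ContinuousOn f (Icc 0 1)) (hB : IsTypeB f α)
    (hvp : IsTangencyLevel f α m vp) (hv : v ∈ Icc 0 1) : reactionPrimitive f v ≤ f vp * v := by
  rcases hv.1.eq_or_lt with rfl | hv0
  · rw [reactionPrimitive_zero, mul_zero]
  rcases lt_or_ge v vp with hlt | hge
  · exact (hvp.lt_mul hf hB ⟨hv0, hlt⟩).le
  · have hprim := reactionPrimitive_sub_le_mul_sub (p := f vp) hf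
      (hvp.mem_Ioo_zero_one hB).1.le hge hv.2 fun s hs => (hvp.strictAntiOn
        ⟨hvp.mem_Ioo.1.le, hvp.mem_Ioo.2.le⟩
        ⟨(hvp.mem_Ioo.1.trans hs.1).le, hs.2.le.trans hv.2⟩ hs.1).le
    rw [hvp.eq_mul] at hprim
    linarith

end TangencyLevel

/-! ### The limit of the critical speeds -/

section SpeedLimit

variable {f y : ℝ → ℝ} {α ε c m vp a b q s μ δ v : ℝ}

theorem IsFirstOrderSolution.le_mul_sub (hε : 0 < ε) (hf : ContinuousOn f (Icc 0 1))
    (hB : IsTypeB f α) (h : IsFirstOrderSolution f ε c y) (hv : v ∈ Icc (0 : ℝ) 1) :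
    y v ≤ c * v - reactionPrimitive f v := by
  have hsub : Icc 0 v ⊆ Icc 0 1 := Icc_subset_Icc_right hv.2
  have := sub_le_sub_of_hasDerivWithinAt_le hv.1 hsub
    (fun s hs => h.hasDerivWithinAt s (hsub hs))
    (fun s hs => ((hasDerivWithinAt_id s _).const_mul c).fun_sub
      (hasDerivWithinAt_reactionPrimitive hf s (hsub hs))) fun s hs => by
      have := mul_le_mul_of_nonneg_left (frontSlope_lt_one hε
        (h.nonneg s (hsub (Ioo_subset_Icc_self hs)))).le (h.speed_pos hε hB).le
      linarith
  simpa only [h.map_zero, reactionPrimitive_zero, mul_zero, sub_zero, id_eq] using this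

theorem IsFirstOrderSolution.lt_speed (hε : 0 < ε) (hf : ContinuousOn f (Icc 0 1))
    (hB : IsTypeB f α) (hvp : IsTangencyLevel f α m vp) (h : IsFirstOrderSolution f ε c y) :
    f vp < c := by
  have hvp01 := hvp.mem_Ioo_zero_one hB
  have hle := h.le_mul_sub hε hf hB (Ioo_subset_Icc_self hvp01)
  have hpos := h.pos vp hvp01
  rw [hvp.eq_mul, mul_comm vp] at hle
  exact lt_of_mul_lt_mul_right (by linarith) hvp01.1.le

theorem IsFirstOrderSolution.mul_sub_lt (hε : 0 < ε) (hf : ContinuousOn f (Icc 0 1))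
    (hB : IsTypeB f α) (h : IsFirstOrderSolution f ε c y) (ha : 0 ≤ a) (hab : a ≤ b) (hb : b ≤ 1)
    (hya : q * a - reactionPrimitive f a < y a) (hμ : 0 ≤ μ)
    (hμq : ∀ v ∈ Icc a b, μ ≤ q * v - reactionPrimitive f v) (hq : q ≤ c * frontSlope ε μ) :
    q * b - reactionPrimitive f b < y b := by
  have hsub : Icc a b ⊆ Icc 0 1 := Icc_subset_Icc ha hb
  refine sub_pos.1 (pos_of_hasDerivWithinAt_nonneg_of_nonneg
    (d := fun v => y v - (q * v - reactionPrimitive f v)) hab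
    (fun v hv => ((h.hasDerivWithinAt v (hsub hv)).fun_sub
      (((hasDerivWithinAt_id v _).const_mul q).fun_sub
        (hasDerivWithinAt_reactionPrimitive hf v (hsub hv)))).mono hsub)
    (sub_pos.2 hya) fun v hv hle => ?_)
  have hμy : μ ≤ y v := (hμq v hv).trans (sub_nonneg.1 hle)
  have := mul_le_mul_of_nonneg_left (monotoneOn_frontSlope hε hμ (hμ.trans hμy) hμy)
    (h.speed_pos hε hB).le
  linarith

theorem IsFirstOrderSolution.mul_sub_le (hε : 0 < ε) (hB : IsTypeB f α)
    (h : IsFirstOrderSolution f ε c y) (hv : v ∈ Icc 0 α) : c * v - ε ≤ y v :=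
  h.eq_energyOfMomentum hε hB hv ▸ sub_le_energyOfMomentum ..

theorem eventually_speed_lt (hf : ContinuousOn f (Icc 0 1)) (hB : IsTypeB f α)
    (hs : ∀ v ∈ Icc 0 1, reactionPrimitive f v ≤ s * v) (hδ : 0 < δ) :
    ∀ᶠ ε in 𝓝[>] (0 : ℝ), ∀ c y, IsFirstOrderSolution f ε c y → c < s + δ := by
  have hα := hB.threshold_mem
  have hμ : 0 < δ * α / 2 := half_pos (mul_pos hδ hα.1)
  have hslope := ((tendsto_frontSlope hμ).const_mul (s + δ)).eventually
    (lt_mem_nhds (show s + δ / 2 < (s + δ) * 1 by linarith))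
  filter_upwards [hslope, self_mem_nhdsWithin, nhdsWithin_le_nhds (Iio_mem_nhds hμ)]
    with ε hslope (hε : 0 < ε) (hεμ : ε < _) c y h
  by_contra! hcon
  have hαα : α ∈ Icc 0 α := right_mem_Icc.2 hα.1.le
  have hyα : (s + δ / 2) * α - reactionPrimitive f α < y α := by
    have hcα := mul_le_mul_of_nonneg_right hcon hα.1.le
    rw [hB.reactionPrimitive_eq_zero hαα]
    linarith [h.mul_sub_le hε hB hαα]
  have hgap : ∀ v ∈ Icc α 1, δ * α / 2 ≤ (s + δ / 2) * v - reactionPrimitive f v := fun v hv => by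
    have := hs v ⟨hα.1.le.trans hv.1, hv.2⟩
    have := mul_le_mul_of_nonneg_left hv.1 hδ.le
    linarith
  have hy1 := h.mul_sub_lt hε hf hB hα.1.le hα.2.le le_rfl hyα hμ.le hgap
    (hslope.le.trans (mul_le_mul_of_nonneg_right hcon (frontSlope_nonneg hε hμ.le)))
  rw [h.map_one] at hy1
  linarith [hgap 1 (right_mem_Icc.2 hα.2.le)]

theorem tendsto_criticalSpeed (hH : HypH f) (hB : IsTypeB f α)
    (hvp : IsTangencyLevel f α m vp) :
    Tendsto (fun ε => criticalSpeed f ε) (𝓝[>] 0) (𝓝 (f vp)) := by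
  rw [Metric.tendsto_nhds]
  intro δ hδ
  filter_upwards [eventually_speed_lt hH.continuousOn hB
    (fun _ => hvp.le_mul hH.continuousOn hB) hδ, self_mem_nhdsWithin] with ε hupper hε
  obtain ⟨y, hy⟩ := exists_isFirstOrderSolution_criticalSpeed hε hH hB
  have hlower := hy.lt_speed hε hH.continuousOn hB hvp
  rw [Real.dist_eq, abs_of_pos (sub_pos.2 hlower)]
  linarith [hupper _ y hy]

end SpeedLimit

/-! ### The limit of the front slopes -/

section DecreasingBranch

variable {f y : ℝ → ℝ} {α ε c m δ v : ℝ} {K : NNReal}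

theorem IsFirstOrderSolution.speed_mul_le (hε : 0 < ε) (hB : IsTypeB f α) (hf1 : f 1 = 0)
    (hm : 0 ≤ m) (hanti : AntitoneOn f (Icc m 1)) (h : IsFirstOrderSolution f ε c y)
    (hv : v ∈ Icc m 1) : c * frontSlope ε (y v) ≤ f v := by
  by_contra! hcon
  have hsub : Icc v 1 ⊆ Icc 0 1 := Icc_subset_Icc_left (hm.trans hv.1)
  have hv01 : v ∈ Icc 0 1 := hsub (left_mem_Icc.2 hv.2)
  have hyv : 0 < y v := (h.nonneg v hv01).lt_of_ne fun h0 => by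
    rw [← h0, frontSlope_zero, mul_zero] at hcon
    exact hcon.not_ge (hB.nonneg hf1 v hv01)
  -- `y` cannot go down through a level `η` at which the slope is still supercritical.
  obtain ⟨η, hη, hη0, hηy⟩ : ∃ η, f v < c * frontSlope ε η ∧ 0 < η ∧ η < y v := by
    have hcont : ContinuousAt (fun t => c * frontSlope ε t) (y v) :=
      ((continuousOn_frontSlope hε).continuousAt (Ici_mem_nhds hyv)).const_mul c
    exact (((hcont.eventually (lt_mem_nhds hcon)).filter_mono nhdsWithin_le_nhds).and
      (Ioo_mem_nhdsLT hyv)).exists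
  have hy1 := pos_of_hasDerivWithinAt_nonneg_of_nonneg (d := fun s => y s - η) hv.2
    (fun s hs => ((h.hasDerivWithinAt s (hsub hs)).mono hsub).sub_const η)
    (sub_pos.2 hηy) fun s hs hηs => by
      have hslope := mul_le_mul_of_nonneg_left (monotoneOn_frontSlope hε hη0.le
        (h.nonneg s (hsub hs)) (sub_nonneg.1 hηs)) (h.speed_pos hε hB).le
      have hfs := hanti hv ⟨hv.1.trans hs.1, hs.2⟩ hs.1
      linarith
  rw [h.map_one] at hy1
  linarith

theorem IsFirstOrderSolution.antitoneOn (hε : 0 < ε) (hB : IsTypeB f α) (hf1 : f 1 = 0)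
    (hm : 0 ≤ m) (hanti : AntitoneOn f (Icc m 1)) (h : IsFirstOrderSolution f ε c y) :
    AntitoneOn y (Icc m 1) := by
  have hsub : Icc m 1 ⊆ Icc 0 1 := Icc_subset_Icc_left hm
  exact antitoneOn_of_hasDerivWithinAt_nonpos (convex_Icc m 1) (h.continuousOn.mono hsub)
    (fun v hv => (h.hasDerivWithinAt v (hsub (interior_subset hv))).mono
      (interior_subset.trans hsub)) fun v hv =>
      sub_nonpos.2 (h.speed_mul_le hε hB hf1 hm hanti (interior_subset hv))

theorem IsFirstOrderSolution.sub_le_speed_mul (hε : 0 < ε) (hB : IsTypeB f α) (hf1 : f 1 = 0)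
    (hm : 0 ≤ m) (hanti : AntitoneOn f (Icc m 1)) (hf : LipschitzOnWith K f (Icc 0 1))
    (h : IsFirstOrderSolution f ε c y) (hδ : 0 < δ) (hv : v ∈ Icc m 1)
    (hyv : 4 * K * y v < δ ^ 2) : f v - δ ≤ c * frontSlope ε (y v) := by
  by_contra! hcon
  have hc := (h.speed_pos hε hB).le
  have hv01 : v ∈ Icc 0 1 := ⟨hm.trans hv.1, hv.2⟩
  have hLip : ∀ s ∈ Icc v 1, f v - f s ≤ K * (s - v) := fun s hs => by
    have := hf.dist_le_mul v hv01 s ⟨hv01.1.trans hs.1, hs.2⟩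
    rw [dist_comm v s, Real.dist_eq, Real.dist_eq, abs_of_nonneg (sub_nonneg.2 hs.1)] at this
    exact (le_abs_self _).trans this
  have hroom : δ < K * (1 - v) := by
    have := hLip 1 (right_mem_Icc.2 hv.2)
    have := mul_nonneg hc (frontSlope_nonneg hε (h.nonneg v hv01))
    linarith
  have hK : 0 < (K : ℝ) := pos_of_mul_pos_left (hδ.trans hroom) (sub_nonneg.2 hv.2)
  -- On `[v, v + δ / (2 K)]` the derivative of `y` is at most `-δ / 2`, which makes `y` negative.
  obtain ⟨w, hKw⟩ : ∃ w, K * (w - v) = δ / 2 := ⟨v + δ / (2 * K), by field_simp; ring⟩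
  have hvw : v ≤ w :=
    sub_nonneg.1 (le_of_mul_le_mul_left (show K * 0 ≤ K * (w - v) by linarith) hK)
  have hw1 : w ≤ 1 := by
    linarith [lt_of_mul_lt_mul_left (show K * (w - v) < K * (1 - v) by linarith) hK.le]
  have hsub : Icc v w ⊆ Icc 0 1 := Icc_subset_Icc hv01.1 hw1
  have hdrop : y w - y v ≤ -(δ / 2) * w - -(δ / 2) * v :=
    sub_le_sub_of_hasDerivWithinAt_le hvw hsub (fun s hs => h.hasDerivWithinAt s (hsub hs))
      (fun s _ => (hasDerivWithinAt_id s _).const_mul (-(δ / 2))) fun s hs => by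
      have hs' := Ioo_subset_Icc_self hs
      have hslope := mul_le_mul_of_nonneg_left (monotoneOn_frontSlope hε (h.nonneg s (hsub hs'))
        (h.nonneg v hv01) (h.antitoneOn hε hB hf1 hm hanti hv
          ⟨hv.1.trans hs'.1, hs'.2.trans hw1⟩ hs'.1)) hc
      have hfs := hLip s ⟨hs'.1, hs'.2.trans hw1⟩
      have := mul_le_mul_of_nonneg_left (sub_le_sub_right hs'.2 v) hK.le
      linarith
  have hyw := mul_nonneg hK.le (h.nonneg w (hsub (right_mem_Icc.2 hvw)))
  have := mul_le_mul_of_nonneg_left hdrop hK.le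
  have : K * (-(δ / 2) * w - -(δ / 2) * v) = -(δ / 2) * (δ / 2) := by rw [← hKw]; ring
  linarith

end DecreasingBranch

/-- The limit as `ε → 0⁺` of the slope of the critical front as a function of its value `v`: it
equals `1` for `v ≤ vp` and `f v / f vp` for `v ≥ vp`. -/
noncomputable def limitSlope (f : ℝ → ℝ) (vp v : ℝ) : ℝ := f (max vp v) / f vp

section SlopeLimit

variable {f y : ℝ → ℝ} {α ε c m vp a b κ η v : ℝ} {K : NNReal}

theorem limitSlope_of_le (hp : f vp ≠ 0) (hv : v ≤ vp) : limitSlope f vp v = 1 := by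
  rw [limitSlope, max_eq_left hv, div_self hp]

theorem limitSlope_of_ge (f : ℝ → ℝ) (hv : vp ≤ v) : limitSlope f vp v = f v / f vp := by
  rw [limitSlope, max_eq_right hv]

theorem exists_lipschitzOnWith_limitSlope (hf : LipschitzOnWith K f (Icc 0 1))
    (hvp : vp ∈ Icc 0 1) : ∃ L, LipschitzOnWith L (limitSlope f vp) (Icc 0 1) := by
  have hmaps : MapsTo (fun v => max vp v) (Icc 0 1) (Icc 0 1) := fun v hv =>
    ⟨hvp.1.trans (le_max_left _ _), max_le hvp.2 hv.2⟩
  have hcomp : limitSlope f vp = (fun x => (f vp)⁻¹ • x) ∘ f ∘ fun v => max vp v := by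
    ext v
    exact div_eq_inv_mul _ _
  rw [hcomp]
  exact ⟨_, (lipschitzWith_smul (f vp)⁻¹).comp_lipschitzOnWith
    (hf.comp (LipschitzWith.id.const_max vp).lipschitzOnWith hmaps)⟩

theorem IsFirstOrderSolution.frontSlope_le_limitSlope (hε : 0 < ε) (hH : HypH f)
    (hB : IsTypeB f α) (hvp : IsTangencyLevel f α m vp) (h : IsFirstOrderSolution f ε c y)
    (hv : v ∈ Icc 0 1) : frontSlope ε (y v) ≤ limitSlope f vp v := by
  have hp := hvp.pos hB
  have hy := h.nonneg v hv
  rcases le_total v vp with hle | hge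
  · rw [limitSlope_of_le hp.ne' hle]
    exact (frontSlope_lt_one hε hy).le
  · have hspeed := h.speed_mul_le hε hB hH.map_one (hvp.argmax_pos hB).le
      hvp.strictAntiOn.antitoneOn ⟨hvp.mem_Ioo.1.le.trans hge, hv.2⟩
    have hc := mul_le_mul_of_nonneg_right (h.lt_speed hε hH.continuousOn hB hvp).le
      (frontSlope_nonneg hε hy)
    rw [limitSlope_of_ge f hge, le_div_iff₀ hp]
    linarith

theorem exists_pos_le_mul_sub_reactionPrimitive (hf : ContinuousOn f (Icc 0 1))
    (hB : IsTypeB f α) (hvp : IsTangencyLevel f α m vp) (ha : 0 < a) (hab : a ≤ b)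
    (hb : b < vp) : ∃ μ, 0 < μ ∧ ∀ v ∈ Icc a b, μ ≤ f vp * v - reactionPrimitive f v := by
  have hsub : Icc a b ⊆ Icc 0 1 := Icc_subset_Icc ha.le (hb.le.trans hvp.mem_Ioo.2.le)
  have hcont : ContinuousOn (fun v => f vp * v - reactionPrimitive f v) (Icc a b) :=
    (continuousOn_const.mul continuousOn_id).sub ((continuousOn_reactionPrimitive hf).mono hsub)
  obtain ⟨t, ht, hmin⟩ := isCompact_Icc.exists_isMinOn (nonempty_Icc.2 hab) hcont
  exact ⟨_, sub_pos.2 (hvp.lt_mul hf hB ⟨ha.trans_le ht.1, ht.2.trans_lt hb⟩),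
    fun v hv => hmin hv⟩

theorem eventually_lt_frontSlope (hf : ContinuousOn f (Icc 0 1)) (hB : IsTypeB f α)
    (hvp : IsTangencyLevel f α m vp) (ha : a ∈ Ioc 0 α) (hab : a ≤ b) (hb : b < vp)
    (hη : 0 < η) :
    ∀ᶠ ε in 𝓝[>] (0 : ℝ), ∀ c y, IsFirstOrderSolution f ε c y → ∀ v ∈ Icc a b,
      1 - η < frontSlope ε (y v) := by
  have hb1 : b ≤ 1 := hb.le.trans hvp.mem_Ioo.2.le
  obtain ⟨ν, hν, hgap⟩ := exists_pos_le_mul_sub_reactionPrimitive hf hB hvp ha.1 hab hb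
  obtain ⟨μ, rfl⟩ : ∃ μ, ν = 2 * μ := ⟨ν / 2, by ring⟩
  have hμ : 0 < μ := by linarith
  have hsub : ∀ v ∈ Icc a b, μ ≤ (f vp - μ) * v - reactionPrimitive f v := fun v hv => by
    have := mul_le_mul_of_nonneg_left (hv.2.trans hb1) hμ.le
    linarith [hgap v hv]
  have hslope := tendsto_frontSlope hμ
  filter_upwards [hslope.eventually (lt_mem_nhds (show 1 - η < 1 by linarith)),
    (hslope.const_mul (f vp)).eventually (lt_mem_nhds (show f vp - μ < f vp * 1 by linarith)),
    self_mem_nhdsWithin, nhdsWithin_le_nhds (Iio_mem_nhds (mul_pos hμ ha.1))]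
    with ε hslope hspeed (hε : 0 < ε) (hεμ : ε < _) c y h v hv
  have hc := (h.lt_speed hε hf hB hvp).le
  have haα : a ∈ Icc 0 α := Ioc_subset_Icc_self ha
  have hya : (f vp - μ) * a - reactionPrimitive f a < y a := by
    have := mul_le_mul_of_nonneg_right hc ha.1.le
    rw [hB.reactionPrimitive_eq_zero haα]
    linarith [h.mul_sub_le hε hB haα]
  have hyv := h.mul_sub_lt hε hf hB ha.1.le hv.1 (hv.2.trans hb1) hya hμ.le
    (fun s hs => hsub s ⟨hs.1, hs.2.trans hv.2⟩)
    (hspeed.le.trans (mul_le_mul_of_nonneg_right hc (frontSlope_nonneg hε hμ.le)))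
  have hμy := (hsub v hv).trans hyv.le
  exact hslope.trans_le (monotoneOn_frontSlope hε hμ.le (hμ.le.trans hμy) hμy)

theorem exists_eventually_lt (hH : HypH f) (hB : IsTypeB f α)
    (hvp : IsTangencyLevel f α m vp) (hκ : 0 < κ) :
    ∃ b ∈ Ico m vp, ∀ᶠ ε in 𝓝[>] (0 : ℝ), ∀ c y, IsFirstOrderSolution f ε c y →
      ∀ v ∈ Icc b 1, y v < κ := by
  have hvp01 := hvp.mem_Ioo_zero_one hB
  obtain ⟨l, hl, hlκ⟩ : ∃ l ∈ Ico m vp, ∀ v ∈ Ioc l vp,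
      f vp * v - reactionPrimitive f v < κ / 2 := by
    have hcont : ContinuousAt (fun v => f vp * v - reactionPrimitive f v) vp :=
      (continuousAt_const.mul continuousAt_id).sub ((continuousOn_reactionPrimitive
        hH.continuousOn).continuousAt (Icc_mem_nhds hvp01.1 hvp01.2))
    have hzero : f vp * vp - reactionPrimitive f vp < κ / 2 := by
      rw [hvp.eq_mul, mul_comm, sub_self]
      exact half_pos hκ
    exact exists_Ioc_subset_of_mem_nhds' (hcont.eventually (gt_mem_nhds hzero)) hvp.mem_Ioo.1
  obtain ⟨b, hlb, hb⟩ := exists_between hl.2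
  refine ⟨b, ⟨hl.1.trans hlb.le, hb⟩, ?_⟩
  filter_upwards [eventually_speed_lt hH.continuousOn hB
    (fun _ => hvp.le_mul hH.continuousOn hB) (half_pos hκ), self_mem_nhdsWithin]
    with ε hspeed (hε : 0 < ε) c y h v hv
  have hc := h.lt_speed hε hH.continuousOn hB hvp
  have hle_vp : ∀ v ∈ Icc b vp, y v < κ := fun v hv => by
    have hv01 : v ∈ Icc 0 1 := ⟨(hvp.argmax_pos hB).le.trans (hl.1.trans (hlb.le.trans hv.1)),
      hv.2.trans hvp01.2.le⟩
    have hcv := mul_le_mul_of_nonneg_left hv01.2 (sub_nonneg.2 hc.le)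
    have hy := h.le_mul_sub hε hH.continuousOn hB hv01
    linarith [hlκ v ⟨hlb.trans_le hv.1, hv.2⟩, hspeed c y h]
  rcases le_total v vp with hle | hge
  · exact hle_vp v ⟨hv.1, hle⟩
  · exact (h.antitoneOn hε hB hH.map_one (hvp.argmax_pos hB).le hvp.strictAntiOn.antitoneOn
      ⟨hvp.mem_Ioo.1.le, hvp01.2.le⟩ ⟨hvp.mem_Ioo.1.le.trans hge, hv.2⟩ hge).trans_lt
        (hle_vp vp ⟨hb.le, le_rfl⟩)

theorem eventually_limitSlope_sub_le (hH : HypH f) (hB : IsTypeB f α)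
    (hf : LipschitzOnWith K f (Icc 0 1)) (hvp : IsTangencyLevel f α m vp) (ha : a ∈ Ioc 0 α)
    (hη : 0 < η) :
    ∀ᶠ ε in 𝓝[>] (0 : ℝ), ∀ c y, IsFirstOrderSolution f ε c y → ∀ v ∈ Icc a 1,
      limitSlope f vp v - η ≤ frontSlope ε (y v) := by
  have hp := hvp.pos hB
  have hm := hvp.argmax_pos hB
  obtain ⟨δ, hδ, hηδ⟩ : ∃ δ, 0 < δ ∧ η * f vp = 2 * δ :=
    ⟨η * f vp / 2, half_pos (mul_pos hη hp), by ring⟩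
  obtain ⟨κ, hκ, hκδ⟩ := exists_pos_mul_lt (sq_pos_of_pos hδ) (4 * K)
  obtain ⟨b, hb, hsmall⟩ := exists_eventually_lt hH hB hvp hκ
  filter_upwards [hsmall, eventually_lt_frontSlope hH.continuousOn hB hvp ha
    (ha.2.trans (hvp.argmax_mem.1.le.trans hb.1)) hb.2 hη,
    eventually_speed_lt hH.continuousOn hB (fun _ => hvp.le_mul hH.continuousOn hB) hδ,
    self_mem_nhdsWithin] with ε hsmall hlarge hspeed (hε : 0 < ε) c y h v hv
  rcases le_total v b with hvb | hbv
  · rw [limitSlope_of_le hp.ne' (hvb.trans hb.2.le)]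
    exact (hlarge c y h v ⟨hv.1, hvb⟩).le
  · have hvm : v ∈ Icc m 1 := ⟨hb.1.trans hbv, hv.2⟩
    have hanti := hvp.strictAntiOn.antitoneOn
    have hyv := hsmall c y h v ⟨hbv, hv.2⟩
    have hlower := h.sub_le_speed_mul hε hB hH.map_one hm.le hanti hf hδ hvm
      ((mul_le_mul_of_nonneg_left hyv.le (by positivity)).trans_lt hκδ)
    have hf_max : f (max vp v) ≤ f v := hanti hvm
      ⟨hvm.1.trans (le_max_right _ _), max_le hvp.mem_Ioo.2.le hv.2⟩ (le_max_right _ _)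
    have hexcess := mul_le_mul_of_nonneg_left
      (frontSlope_lt_one hε (h.nonneg v ⟨hm.le.trans hvm.1, hv.2⟩)).le
      (sub_nonneg.2 (h.lt_speed hε hH.continuousOn hB hvp).le)
    rw [sub_le_iff_le_add, limitSlope, div_le_iff₀ hp]
    linarith [hspeed c y h]

end SlopeLimit

/-! ### The inviscid profile -/

section InviscidProfile

variable {f V W : ℝ → ℝ} {α c z₀ v₀ : ℝ} {K : NNReal}

theorem exists_isInviscidProfile (hB : IsTypeB f α) (hf1 : f 1 = 0)
    (hf : LipschitzOnWith K f (Icc 0 1)) (hc : 0 < c) (z₀ : ℝ) (hv₀ : v₀ ∈ Ioo α 1) :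
    ∃ V, IsInviscidProfile f c z₀ v₀ V ∧ Tendsto V atTop (𝓝 1) := by
  have hα := hB.threshold_mem
  have hsub : Ioo α 1 ⊆ Icc 0 1 := fun v hv => ⟨hα.1.le.trans hv.1.le, hv.2.le⟩
  have hbound : ∀ v ∈ Ioo α 1, ∀ u ∈ Icc (0 : ℝ) 1, f u = 0 →
      f v / c ≤ (K + 1) / c * dist v u := fun v hv u hu hfu => by
    have hLip := hf.dist_le_mul v (hsub hv) u hu
    rw [hfu, Real.dist_eq, sub_zero] at hLip
    rw [div_mul_eq_mul_div, add_one_mul]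
    gcongr
    linarith [le_abs_self (f v), dist_nonneg (x := v) (y := u)]
  obtain ⟨V, hV, hd, hV0, -, htop⟩ := exists_heteroclinic_orbit (G := fun v => f v / c) z₀
    ((hf.continuousOn.mono hsub).div_const c) (fun v hv => div_pos (hB.pos v hv) hc)
    (C := (K + 1) / c) (by positivity)
    (fun v hv => by
      have := hbound v hv α ⟨hα.1.le, hα.2.le⟩ (hB.eq_zero α ⟨hα.1.le, le_rfl⟩)
      rwa [Real.dist_eq, abs_of_pos (sub_pos.2 hv.1)] at this)
    (fun v hv => by
      have := hbound v hv 1 ⟨zero_le_one, le_rfl⟩ hf1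
      rwa [dist_comm, Real.dist_eq, abs_of_pos (sub_pos.2 hv.2)] at this)
    hv₀
  refine ⟨V, ⟨fun z => hsub (hV z), fun z => (hd z).differentiableAt, fun z => ?_, hV0⟩, htop⟩
  rw [(hd z).deriv, mul_div_cancel₀ _ hc.ne']

theorem IsInviscidProfile.hasDerivAt (hc : 0 < c) (hV : IsInviscidProfile f c z₀ v₀ V) (z : ℝ) :
    HasDerivAt V (f (V z) / c) z :=
  (hV.differentiable z).hasDerivAt.congr_deriv
    (eq_div_of_mul_eq hc.ne' ((mul_comm _ _).trans (hV.ode z)))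

theorem IsInviscidProfile.monotone (hB : IsTypeB f α) (hf1 : f 1 = 0) (hc : 0 < c)
    (hV : IsInviscidProfile f c z₀ v₀ V) : Monotone V :=
  monotone_of_hasDerivAt_nonneg (hV.hasDerivAt hc) fun z =>
    div_nonneg (hB.nonneg hf1 _ (hV.mem_Icc z)) hc.le

theorem IsInviscidProfile.unique (hf : LipschitzOnWith K f (Icc 0 1)) (hc : 0 < c)
    (hV : IsInviscidProfile f c z₀ v₀ V) (hW : IsInviscidProfile f c z₀ v₀ W) : V = W := by
  have hfield : LipschitzOnWith (‖c⁻¹‖₊ * K) (fun x => f x / c) (Icc 0 1) := by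
    simp only [div_eq_inv_mul]
    exact (lipschitzWith_smul c⁻¹).comp_lipschitzOnWith hf
  exact ODE_solution_unique_univ (fun _ => hfield)
    (fun z => ⟨hV.hasDerivAt hc z, hV.mem_Icc z⟩) (fun z => ⟨hW.hasDerivAt hc z, hW.mem_Icc z⟩)
    (hV.initial.trans hW.initial.symm)

end InviscidProfile

theorem piecewiseLinearProfile_eq_max_min (z₀ v₀ z : ℝ) :
    piecewiseLinearProfile z₀ v₀ z = max 0 (min 1 (z - z₀ + v₀)) := by
  unfold piecewiseLinearProfile
  grind

theorem gluedProfile_of_le {p z : ℝ} (L R : ℝ → ℝ) (hz : z ≤ p) : gluedProfile p L R z = L z :=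
  if_pos hz

theorem gluedProfile_of_ge {p z : ℝ} {L R : ℝ → ℝ} (h : L p = R p) (hz : p ≤ z) :
    gluedProfile p L R z = R z := by
  rcases hz.eq_or_lt with rfl | hlt
  · rw [gluedProfile_of_le L R le_rfl, h]
  · exact if_neg hlt.not_ge

theorem continuous_gluedProfile {p : ℝ} {L R : ℝ → ℝ} (hL : Continuous L) (hR : Continuous R)
    (h : L p = R p) : Continuous (gluedProfile p L R) :=
  hL.if_le hR continuous_id continuous_const fun _ hz => hz ▸ h

/-- The limit of the critical fronts: the line of slope `1` through `(0, α)`, cut off at height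
`0`, followed from height `vp` on by the inviscid profile `V`. -/
noncomputable def limitFront (α vp : ℝ) (V : ℝ → ℝ) : ℝ → ℝ :=
  gluedProfile (vp - α) (piecewiseLinearProfile 0 α) V

section LimitFront

variable {f V : ℝ → ℝ} {α vp z : ℝ}

theorem limitFront_of_le (V : ℝ → ℝ) (hvp : vp ≤ 1) (hz : z ≤ vp - α) :
    limitFront α vp V z = max 0 (z + α) := by
  rw [limitFront, gluedProfile_of_le _ _ hz, piecewiseLinearProfile_eq_max_min, sub_zero,
    min_eq_right (by linarith)]

theorem IsInviscidProfile.piecewiseLinearProfile_eq {c : ℝ}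
    (hV : IsInviscidProfile f c (vp - α) vp V) :
    piecewiseLinearProfile 0 α (vp - α) = V (vp - α) := by
  have hvp := hV.mem_Icc (vp - α)
  rw [hV.initial] at hvp ⊢
  rw [piecewiseLinearProfile_eq_max_min, sub_zero, sub_add_cancel, min_eq_right hvp.2,
    max_eq_right hvp.1]

theorem IsInviscidProfile.limitFront_of_ge {c : ℝ} (hV : IsInviscidProfile f c (vp - α) vp V)
    (hz : vp - α ≤ z) : limitFront α vp V z = V z :=
  gluedProfile_of_ge hV.piecewiseLinearProfile_eq hz

theorem IsInviscidProfile.continuous_limitFront {c : ℝ}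
    (hV : IsInviscidProfile f c (vp - α) vp V) : Continuous (limitFront α vp V) := by
  refine continuous_gluedProfile ?_ hV.differentiable.continuous hV.piecewiseLinearProfile_eq
  simp only [funext (piecewiseLinearProfile_eq_max_min 0 α)]
  fun_prop

theorem IsInviscidProfile.limitFront_mem_Icc {c : ℝ} (hV : IsInviscidProfile f c (vp - α) vp V)
    (z : ℝ) : limitFront α vp V z ∈ Icc 0 1 := by
  rcases le_total z (vp - α) with hz | hz
  · have hvp : vp ≤ 1 := hV.initial ▸ (hV.mem_Icc (vp - α)).2
    rw [limitFront_of_le V hvp hz]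
    exact ⟨le_max_left _ _, max_le zero_le_one (by linarith)⟩
  · rw [hV.limitFront_of_ge hz]
    exact hV.mem_Icc z

theorem IsInviscidProfile.hasDerivWithinAt_limitFront (hB : IsTypeB f α) (hf1 : f 1 = 0)
    (hp : 0 < f vp) (hV : IsInviscidProfile f (f vp) (vp - α) vp V) (hz : 0 ≤ z) :
    HasDerivWithinAt (limitFront α vp V) (limitSlope f vp (limitFront α vp V z)) (Ici z) z := by
  have hvp : vp ≤ 1 := hV.initial ▸ (hV.mem_Icc (vp - α)).2
  rcases lt_or_ge z (vp - α) with hlt | hge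
  · have hline : limitFront α vp V =ᶠ[𝓝 z] fun s => s + α := by
      filter_upwards [Iio_mem_nhds hlt, Ioi_mem_nhds (show -α < z by linarith [hB.threshold_mem.1])]
        with s (hs : s < _) (hs' : -α < s)
      rw [limitFront_of_le V hvp hs.le, max_eq_right (by linarith)]
    rw [limitSlope_of_le hp.ne' (by rw [hline.eq_of_nhds]; linarith)]
    exact (((hasDerivAt_id z).add_const α).congr_of_eventuallyEq hline).hasDerivWithinAt
  · have hVz : vp ≤ V z := hV.initial.symm.trans_le (hV.monotone hB hf1 hp hge)
    rw [hV.limitFront_of_ge hge, limitSlope_of_ge f hVz]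
    exact (hV.hasDerivAt hp z).hasDerivWithinAt.congr
      (fun s hs => hV.limitFront_of_ge (hge.trans hs)) (hV.limitFront_of_ge hge)

end LimitFront

/-! ### Uniform convergence of the critical fronts -/

section FrontConvergence

variable {f v v' V : ℝ → ℝ} {α m vp a δ η z : ℝ} {K : NNReal}

theorem IsInviscidProfile.abs_sub_limitFront_le (hB : IsTypeB f α) (hf1 : f 1 = 0)
    (hp : 0 < f vp) (hLip : LipschitzOnWith K (limitSlope f vp) (Icc 0 1))
    (hV : IsInviscidProfile f (f vp) (vp - α) vp V) (hαvp : α ≤ vp)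
    (hv : ∀ z, HasDerivAt v (v' z) z)
    (hvI : ∀ z, v z ∈ Icc 0 1) (hv0 : v 0 = α)
    (hδ : ∀ z, 0 ≤ z → |v' z - limitSlope f vp (v z)| ≤ δ) (hz : 0 ≤ z) :
    |v z - limitFront α vp V z| ≤ gronwallBound 0 K δ z := by
  have h0 : v 0 = limitFront α vp V 0 := by
    have hα := hB.threshold_mem.1.le
    rw [limitFront_of_le V (hV.initial ▸ (hV.mem_Icc (vp - α)).2) (sub_nonneg.2 hαvp), zero_add,
      max_eq_right hα, hv0]
  have := dist_le_of_approx_trajectories_ODE_of_mem (v := fun _ => limitSlope f vp)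
    (s := fun _ => Icc 0 1) (δ := 0) (εg := 0) (fun _ _ => hLip)
    (fun t _ => (hv t).continuousAt.continuousWithinAt) (fun t _ => (hv t).hasDerivWithinAt)
    (fun t ht => hδ t ht.1) (fun t _ => hvI t) hV.continuous_limitFront.continuousOn
    (fun t ht => hV.hasDerivWithinAt_limitFront hB hf1 hp ht.1) (fun t _ => (dist_self _).le)
    (fun t _ => hV.limitFront_mem_Icc t) (by rw [h0, dist_self]) z ⟨hz, le_rfl⟩
  rwa [sub_zero, add_zero] at this

theorem abs_sub_max_le_of_le_deriv (hv : Differentiable ℝ v) (hmono : Monotone v)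
    (hnonneg : ∀ z, 0 ≤ v z) (hα : v 0 ≤ 1) (ha : a ∈ Icc 0 (v 0)) (hδ : 0 ≤ δ)
    (hle : ∀ z, deriv v z ≤ 1) (hge : ∀ z ≤ 0, a ≤ v z → 1 - δ ≤ deriv v z) (hz : z ≤ 0) :
    |v z - max 0 (z + v 0)| ≤ a + δ := by
  have hlower : ∀ z ≤ 0, z + v 0 ≤ v z := fun z hz => by
    linarith [image_sub_le_mul_sub_of_deriv_le hv hle hz]
  have hupper : ∀ z ∈ Icc (a - v 0) 0, v z ≤ z + v 0 + δ := fun z hz => by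
    have hgrowth := (convex_Icc (a - v 0) 0).mul_sub_le_image_sub_of_le_deriv
      hv.continuous.continuousOn hv.differentiableOn
      (fun s hs => by
        have hs := interior_subset hs
        exact hge s hs.2 (by linarith [hs.1, hlower s hs.2]))
      z hz 0 ⟨hz.1.trans hz.2, le_rfl⟩ hz.2
    have : δ * -z ≤ δ * 1 := mul_le_mul_of_nonneg_left (by linarith [hz.1, ha.1]) hδ
    linarith
  rw [abs_of_nonneg (sub_nonneg.2 (max_le (hnonneg z) (hlower z hz))), sub_le_iff_le_add]
  rcases le_total (a - v 0) z with hz' | hz'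
  · linarith [hupper z ⟨hz', hz⟩, le_max_right 0 (z + v 0), ha.1]
  · linarith [hmono hz', hupper _ ⟨le_rfl, sub_nonpos.2 ha.2⟩, le_max_left 0 (z + v 0)]

theorem eventually_abs_deriv_sub_limitSlope_le (hH : HypH f) (hB : IsTypeB f α)
    (hf : LipschitzOnWith K f (Icc 0 1)) (hvp : IsTangencyLevel f α m vp) (ha : a ∈ Ioc 0 α)
    (hδ : 0 < δ) :
    ∀ᶠ ε in 𝓝[>] (0 : ℝ), ∀ v, IsCriticalFront f α ε v → ∀ z, a ≤ v z →
      |deriv v z - limitSlope f vp (v z)| ≤ δ := by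
  filter_upwards [eventually_limitSlope_sub_le hH hB hf hvp ha hδ, self_mem_nhdsWithin]
    with ε hslope (hε : 0 < ε) v hv z hz
  obtain ⟨y, hy⟩ := exists_isFirstOrderSolution_criticalSpeed hε hH hB
  have hvz := hv.1.mem_Icc z
  rw [(hv.hasDerivAt hε hH hB hf hy z).deriv, abs_le]
  constructor
  · linarith [hslope _ y hy (v z) ⟨hz, hvz.2⟩]
  · linarith [hy.frontSlope_le_limitSlope hε hH hB hvp hvz]

theorem eventually_abs_sub_limitFront_le_of_nonpos (hH : HypH f) (hB : IsTypeB f α)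
    (hf : LipschitzOnWith K f (Icc 0 1)) (hvp : IsTangencyLevel f α m vp) (V : ℝ → ℝ)
    (hη : 0 < η) :
    ∀ᶠ ε in 𝓝[>] (0 : ℝ), ∀ v, IsCriticalFront f α ε v → ∀ z ≤ 0,
      |v z - limitFront α vp V z| ≤ η := by
  have hα := hB.threshold_mem
  have hαvp := hvp.threshold_lt
  have ha : 0 < min α (η / 2) := lt_min hα.1 (half_pos hη)
  filter_upwards [eventually_abs_deriv_sub_limitSlope_le hH hB hf hvp ⟨ha, min_le_left _ _⟩
    (half_pos hη)] with ε hslope v ⟨hv, hv0⟩ z hz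
  have hclose := abs_sub_max_le_of_le_deriv hv.differentiable hv.monotone
    (fun s => (hv.mem_Icc s).1) (hv0.trans_le hα.2.le)
    ⟨ha.le, (min_le_left _ _).trans hv0.ge⟩ (half_pos hη).le
    (fun s => (le_abs_self _).trans (hv.slope_lt_one s).le)
    (fun s hs has => by
      have hbound := (abs_le.1 (hslope v ⟨hv, hv0⟩ s has)).1
      rw [limitSlope_of_le (hvp.pos hB).ne'
        ((hv.monotone hs).trans (hv0.trans_le hαvp.le))] at hbound
      linarith) hz
  rw [limitFront_of_le V hvp.mem_Ioo.2.le (hz.trans (sub_nonneg.2 hαvp.le)), ← hv0]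
  linarith [min_le_right α (η / 2)]

theorem exists_pos_gronwallBound_lt (K : NNReal) (Z : ℝ) (hη : 0 < η) :
    ∃ δ, 0 < δ ∧ gronwallBound 0 K δ Z < η := by
  have hcont := (gronwallBound_continuous_ε 0 K Z).continuousAt (x := 0)
  have hsmall := (hcont.eventually (gt_mem_nhds (show gronwallBound 0 K 0 Z < η by
    rwa [gronwallBound_ε0_δ0]))).filter_mono (nhdsWithin_le_nhds (s := Ioi 0))
  exact ((eventually_mem_nhdsWithin (a := (0 : ℝ)) (s := Ioi 0)).and hsmall).exists

theorem eventually_abs_sub_limitFront_le_of_nonneg (hH : HypH f) (hB : IsTypeB f α)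
    (hf : LipschitzOnWith K f (Icc 0 1)) (hvp : IsTangencyLevel f α m vp)
    (hV : IsInviscidProfile f (f vp) (vp - α) vp V) (hVtop : Tendsto V atTop (𝓝 1))
    (hη : 0 < η) :
    ∀ᶠ ε in 𝓝[>] (0 : ℝ), ∀ v, IsCriticalFront f α ε v → ∀ z ≥ 0,
      |v z - limitFront α vp V z| ≤ η := by
  have hα := hB.threshold_mem
  have hαvp := hvp.threshold_lt
  obtain ⟨L, hL⟩ := exists_lipschitzOnWith_limitSlope hf
    (Ioo_subset_Icc_self (hvp.mem_Ioo_zero_one hB))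
  obtain ⟨Z, htail⟩ := ((hVtop.eventually (lt_mem_nhds (show 1 - η / 2 < 1 by linarith))).and
    (eventually_ge_atTop (vp - α))).exists_forall_of_atTop
  have hZ := (htail Z le_rfl).2
  have hZ0 : 0 ≤ Z := (sub_nonneg.2 hαvp.le).trans hZ
  obtain ⟨δ, hδ, hδη⟩ := exists_pos_gronwallBound_lt L Z (half_pos hη)
  filter_upwards [eventually_abs_deriv_sub_limitSlope_le hH hB hf hvp ⟨hα.1, le_rfl⟩ hδ]
    with ε hslope v hv z hz
  have hcompact : ∀ z ∈ Icc 0 Z, |v z - limitFront α vp V z| ≤ η / 2 := fun z hz =>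
    calc |v z - limitFront α vp V z| ≤ gronwallBound 0 L δ z :=
          hV.abs_sub_limitFront_le hB hH.map_one (hvp.pos hB) hL hαvp.le
            (fun s => (hv.1.differentiable s).hasDerivAt) hv.1.mem_Icc hv.2
            (fun s hs => hslope v hv s (hv.2.symm.trans_le (hv.1.monotone hs))) hz.1
      _ ≤ gronwallBound 0 L δ Z := gronwallBound_mono le_rfl hδ.le L.2 hz.2
      _ ≤ η / 2 := hδη.le
  rcases le_total z Z with hzZ | hZz
  · exact (hcompact z ⟨hz, hzZ⟩).trans (half_le_self hη.le)
  -- Beyond `Z` both `v` and `V` are close to `1`.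
  · have hvZ := (abs_le.1 (hcompact Z ⟨hZ0, le_rfl⟩)).1
    rw [hV.limitFront_of_ge hZ] at hvZ
    rw [hV.limitFront_of_ge (hZ.trans hZz), abs_le]
    constructor
    · linarith [hv.1.monotone hZz, (htail Z le_rfl).1, (hV.mem_Icc z).2]
    · linarith [(hv.1.mem_Icc z).2, (htail z hZz).1]

theorem tendstoUniformly_criticalFront (hH : HypH f) (hB : IsTypeB f α)
    (hf : LipschitzOnWith K f (Icc 0 1)) (hvp : IsTangencyLevel f α m vp)
    (hV : IsInviscidProfile f (f vp) (vp - α) vp V) (hVtop : Tendsto V atTop (𝓝 1))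
    {v : ℝ → ℝ → ℝ} (hv : ∀ ε : ℝ, 0 < ε → IsCriticalFront f α ε (v ε)) :
    TendstoUniformly v (limitFront α vp V) (𝓝[>] 0) := by
  rw [Metric.tendstoUniformly_iff]
  intro η hη
  filter_upwards [eventually_abs_sub_limitFront_le_of_nonpos hH hB hf hvp V (half_pos hη),
    eventually_abs_sub_limitFront_le_of_nonneg hH hB hf hvp hV hVtop (half_pos hη),
    self_mem_nhdsWithin] with ε hnonpos hnonneg (hε : 0 < ε) z
  rw [dist_comm, Real.dist_eq]
  refine lt_of_le_of_lt ?_ (half_lt_self hη)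
  rcases le_total z 0 with hz | hz
  · exact hnonpos _ (hv ε hε) z hz
  · exact hnonneg _ (hv ε hε) z hz

end FrontConvergence

theorem mainTheorem2 (f : ℝ → ℝ) (α : ℝ) (hH : HypH f) (hB : IsTypeB f α)
    (hF : HypFOn f α 1) :
    -- the critical speed and the normalized critical front are well defined
    (∀ ε : ℝ, 0 < ε →
      {c : ℝ | IsAdmissibleSpeed f ε c} = {criticalSpeed f ε} ∧
      ∃! v : ℝ → ℝ, IsCriticalFront f α ε v) ∧
    -- `vp` is the largest solution of `F(v) = v f(v)`
    ∃ vp : ℝ, vp ∈ Ioo α 1 ∧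
      IsGreatest {v : ℝ | v ∈ Icc (0 : ℝ) 1 ∧ reactionPrimitive f v = v * f v} vp ∧
      -- convergence of the critical speeds
      Tendsto (fun ε => criticalSpeed f ε) (𝓝[>] 0) (𝓝 (f vp)) ∧
      -- uniform convergence of the critical fronts to the glued profile
      ∃ V : ℝ → ℝ, IsInviscidProfile f (f vp) (vp - α) vp V ∧
        (∀ W : ℝ → ℝ, IsInviscidProfile f (f vp) (vp - α) vp W → W = V) ∧
        ∀ v : ℝ → ℝ → ℝ, (∀ ε : ℝ, 0 < ε → IsCriticalFront f α ε (v ε)) →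
          TendstoUniformly v
            (gluedProfile (vp - α) (piecewiseLinearProfile 0 α) V) (𝓝[>] 0) := by
  obtain ⟨K, hf⟩ := exists_lipschitzOnWith_of_isTypeB hB hF.locallyLipschitz
  refine ⟨fun ε hε => ⟨setOf_isAdmissibleSpeed_eq hε hH hB,
    existsUnique_isCriticalFront hε hH hB hf⟩, ?_⟩
  obtain ⟨m, vp, hvp⟩ := exists_isTangencyLevel hH hB hF
  have hvpα : vp ∈ Ioo α 1 := ⟨hvp.threshold_lt, hvp.mem_Ioo.2⟩
  obtain ⟨V, hV, hVtop⟩ := exists_isInviscidProfile hB hH.map_one hf (hvp.pos hB) (vp - α) hvpα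
  exact ⟨vp, hvpα, hvp.isGreatest hH.continuousOn hB, tendsto_criticalSpeed hH hB hvp, V, hV,
    fun W hW => hW.unique hf (hvp.pos hB) hV,
    fun v hv => tendstoUniformly_criticalFront hH hB hf hvp hV hVtop hv⟩
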